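/- Let $n\ge 0$ be an integer and let $V=\mathbb{C}^{2n|1}$ have homogeneous basis $u_1,\dots,u_{2n}$ (even), $u_{2n+1}$ (odd), with the even, $(-1)$-supersymmetric bilinear form $B$ given by $B(u_i,u_{2n+1-i})=-B(u_{2n+1-i},u_i)=1$ for $1\le i\le n$, $B(u_{2n+1},u_{2n+1})=1$, and all other values zero. Let $\mathfrak{spo}(2n|1)\subset\mathfrak{gl}(2n|1)$ be the Lie superalgebra preserving $B$, with Cartan subalgebra $\mathfrak t=\bigoplus_{i=1}^n\mathbb{C}(E_{i,i}-E_{2n+1-i,2n+1-i})$ (weights are written as $n$-tuples in the dual basis) and $\mathfrak n^+$ spanned by the strictly upper triangular matrices in $\mathfrak{sp}(2n)$ together with $E_{k,2n+1}+E_{2n+1,2n+1-k}$, $1\le k\le n$. The exterior superalgebra $\Lambda(V)$ is generated by anticommuting variables $\eta_1,\dots,\eta_{2n}$ and a commuting variable $x=x_{2n+1}$; it is graded by $\Lambda^k(V)$, all generators having degree $1$. With $z_i=\eta_i$ for $i\le 2n$ and $z_{2n+1}=x$, the matrix $E_{i,j}$ acts on $\Lambda(V)$ as $z_i\partial_{z_j}$.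 An element $p\in\Lambda(V)$ is harmonic if $D_{22}\,p=0$, where $$D_{22}=\partial_x^2+2\sum_{i=1}^n\partial_{\eta_i}\partial_{\eta_{2n+1-i}}.$$ A highest weight vector is a nonzero weight vector for $\mathfrak t$ that is annihilated by $\mathfrak n^+$. For $I=\{i_1<\dots<i_a\}\subseteq\{1,\dots,2n\}$ put $\eta(I)=\eta_{i_1}\cdots\eta_{i_a}$ and $\underline I=\{2n+1-i: i\in I\}$, and let $[k]=\{1,\dots,k\}$. For $n+1\le k\le 2n+1$ define $$\Delta_k=\sum_{a=0}^{k-n-1} b_a\,x^{2(k-n-a)-1}\sum_{\substack{I\subseteq\{2n-k+2,\dots,n\}\\ |I|=a}}\eta\big([2n+1-k]\cup I\cup\underline I\big),\qquad b_a=\prod_{r=0}^{a-1}\big(2(k-n-r)-1\big),$$ and let $s_{n,k}=\eta([k])$ for $0\le k\le n$ and $s_{n,k}=\Delta_k$ for $n+1\le k\le 2n+1$. Then for every $0\le k\le 2n+1$ the vector $s_{n,k}$ lies in $\Lambda^k(V)$ and is a harmonic $\mathfrak{spo}(2n|1)$-highest weight vector of highest weight $(1_m,0_{n-m})$ with $m=\min(k,2n+1-k)$,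 where $1_m$ and $0_{n-m}$ denote $m$ ones and $n-m$ zeros. These vectors form the complete list of harmonic highest weight vectors in $\Lambda(V)$: every harmonic highest weight vector lying in some $\Lambda^k(V)$ has $k\le 2n+1$ and is a nonzero scalar multiple of $s_{n,k}$; moreover $s_{n,0},\dots,s_{n,2n+1}$ are linearly independent and span the space of all harmonic elements of $\Lambda(V)$ annihilated by $\mathfrak n^+$. -/

import Mathlib

noncomputable section

namespace SpoHarmonic

open Polynomial

/-! ## The superspace `V = ℂ^{2n|1}`, its form and `spo(2n|1)`

The basis `u_1, …, u_{2n}` of the even part is indexed by `Fin (2 * n)` (so `u_{i+1}` has index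
`i`), and the basis vector `u_{2n+1}` of the odd part by `Unit`. The involution
`i ↦ 2n + 1 - i` of `{1, …, 2n}` is `Fin.rev`. -/

/-- Index set of the homogeneous basis `u_1, …, u_{2n} | u_{2n+1}` of `V`. -/
abbrev Idx (n : ℕ) : Type := Fin (2 * n) ⊕ Unit

/-- The parity of the basis vectors of `V`. -/
def par (n : ℕ) : Idx n → ZMod 2
  | Sum.inl _ => 0
  | Sum.inr _ => 1

/-- The index `i ∈ {1, …, n}` seen in `{1, …, 2n}`. -/
def emb (n : ℕ) (i : Fin n) : Fin (2 * n) := Fin.castLE (by omega) i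

/-- The matrix of the even, non-degenerate, `(-1)`-supersymmetric form `B` on `V`:
`B(u_i, u_{2n+1-i}) = 1 = -B(u_{2n+1-i}, u_i)` for `1 ≤ i ≤ n`, `B(u_{2n+1}, u_{2n+1}) = 1`,
all other values being zero. -/
def formB (n : ℕ) : Matrix (Idx n) (Idx n) ℂ
  | Sum.inl i, Sum.inl j => if j = i.rev then (if i.val < n then 1 else -1) else 0
  | Sum.inr _, Sum.inr _ => 1
  | _, _ => 0

/-- The part of parity `p` of `spo(2n|1)`: the homogeneous `X ∈ gl(2n|1)` of parity `p` with
`B(X v, w) + (-1)^{|X||v|} B(v, X w) = 0` for all homogeneous `v, w`; the condition is written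
for the basis vectors `v = u_i`, `w = u_j`. -/
def spoPart (n : ℕ) (p : ZMod 2) : Submodule ℂ (Matrix (Idx n) (Idx n) ℂ) where
  carrier := {X | (∀ i j, par n i + par n j ≠ p → X i j = 0) ∧
    ∀ i j, (X.transpose * formB n) i j +
      (-1 : ℂ) ^ (p * par n i).val * (formB n * X) i j = 0}
  zero_mem' := by simp
  add_mem' := by
    rintro X Y ⟨h1, h2⟩ ⟨h3, h4⟩
    refine ⟨fun i j h => by simp [h1 i j h, h3 i j h], fun i j => ?_⟩
    simp only [Matrix.transpose_add, Matrix.add_mul, Matrix.mul_add, Matrix.add_apply]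
    linear_combination h2 i j + h4 i j
  smul_mem' := by
    rintro c X ⟨h1, h2⟩
    refine ⟨fun i j h => by simp [h1 i j h], fun i j => ?_⟩
    simp only [Matrix.transpose_smul, Matrix.smul_mul, Matrix.mul_smul, Matrix.smul_apply,
      smul_eq_mul]
    linear_combination c * h2 i j

/-- The orthosymplectic Lie superalgebra `spo(2n|1)`, as a subspace of `gl(2n|1)`. -/
def spo (n : ℕ) : Submodule ℂ (Matrix (Idx n) (Idx n) ℂ) := spoPart n 0 ⊔ spoPart n 1

/-- The element `E_{i,i} - E_{2n+1-i,2n+1-i}`, `1 ≤ i ≤ n`, of the Cartan subalgebra. These form a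
basis of the Cartan subalgebra, and weights are written in the dual basis. -/
def cartanElt (n : ℕ) (i : Fin n) : Matrix (Idx n) (Idx n) ℂ :=
  Matrix.single (Sum.inl (emb n i)) (Sum.inl (emb n i)) 1 -
    Matrix.single (Sum.inl (emb n i).rev) (Sum.inl (emb n i).rev) 1

/-- The odd positive root vector `E_{k,2n+1} + E_{2n+1,2n+1-k}`, `1 ≤ k ≤ n`. -/
def oddRootElt (n : ℕ) (k : Fin n) : Matrix (Idx n) (Idx n) ℂ :=
  Matrix.single (Sum.inl (emb n k)) (Sum.inr ()) 1 +
    Matrix.single (Sum.inr ()) (Sum.inl (emb n k).rev) 1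

/-- The even part of the nilradical of the Borel subalgebra of `spo(2n|1)`: the strictly upper
triangular matrices of `sp(2n)`. -/
def nPlusEven (n : ℕ) : Submodule ℂ (Matrix (Idx n) (Idx n) ℂ) where
  carrier := {X | X ∈ spoPart n 0 ∧
    ∀ i j : Fin (2 * n), j ≤ i → X (Sum.inl i) (Sum.inl j) = 0}
  zero_mem' := ⟨Submodule.zero_mem _, fun _ _ _ => rfl⟩
  add_mem' := by
    rintro X Y ⟨h1, h2⟩ ⟨h3, h4⟩
    exact ⟨Submodule.add_mem _ h1 h3, fun i j h => by simp [h2 i j h, h4 i j h]⟩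
  smul_mem' := by
    rintro c X ⟨h1, h2⟩
    exact ⟨Submodule.smul_mem _ c h1, fun i j h => by simp [h2 i j h]⟩

/-- The nilradical of the Borel subalgebra of `spo(2n|1)`. -/
def nPlus (n : ℕ) : Submodule ℂ (Matrix (Idx n) (Idx n) ℂ) :=
  nPlusEven n ⊔ Submodule.span ℂ (Set.range (oddRootElt n))

lemma oddRootElt_mem (n : ℕ) (k : Fin n) : oddRootElt n k ∈ spoPart n 1 := by
  have hk := k.isLt
  have h1 : ZMod.val (1 : ZMod 2) = 1 := rfl
  constructor
  · rintro (i | i) (j | j) <;> simp [par, oddRootElt]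
  · rintro (i | i) (j | j)
    all_goals simp only [oddRootElt, Matrix.transpose_add, Matrix.add_mul, Matrix.mul_add,
      Matrix.transpose_single, Matrix.add_apply]
    all_goals simp [Matrix.mul_apply, Matrix.single_apply, formB, emb, par, ite_and, Fin.ext_iff,
      h1]
    all_goals grind

/-- The nilradical above is contained in `spo(2n|1)`. -/
lemma nPlus_le_spo (n : ℕ) : nPlus n ≤ spo n := by
  refine sup_le (fun A h => Submodule.mem_sup_left h.1) (Submodule.span_le.2 ?_)
  rintro _ ⟨k, rfl⟩
  exact Submodule.mem_sup_right (oddRootElt_mem n k)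

/-! ## The exterior superalgebra `Λ(V)` -/

/-- The Grassmann algebra `Λ(V_0)` generated by `η_1, …, η_{2n}`. -/
abbrev Grass (n : ℕ) : Type := ExteriorAlgebra ℂ (Fin (2 * n) → ℂ)

/-- The exterior superalgebra `Λ(V) = Λ(V_0) ⊗ S(V_1)`, i.e. the polynomials in the even variable
`x_{2n+1}`, with coefficients in the Grassmann algebra generated by `η_1, …, η_{2n}`. The variable
`X` of polynomials is central. -/
abbrev SuperExt (n : ℕ) : Type := (Grass n)[X]

/-- The generator `η_i` of the Grassmann algebra. -/
def eta (n : ℕ) (i : Fin (2 * n)) : Grass n := ExteriorAlgebra.ι ℂ (Pi.single i 1)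

/-- The homogeneous component `Λ^k(V)`, where all of `η_1, …, η_{2n}, x_{2n+1}` have degree one. -/
def superExtPower (n k : ℕ) : Submodule ℂ (SuperExt n) where
  carrier := {p | ∀ d, (d ≤ k → p.coeff d ∈ ⋀[ℂ]^(k - d) (Fin (2 * n) → ℂ)) ∧
    (k < d → p.coeff d = 0)}
  zero_mem' := fun d => ⟨fun _ => by simp, fun _ => by simp⟩
  add_mem' := by
    intro p q hp hq d
    refine ⟨fun h => ?_, fun h => ?_⟩
    · rw [coeff_add]
      exact Submodule.add_mem _ ((hp d).1 h) ((hq d).1 h)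
    · rw [coeff_add, (hp d).2 h, (hq d).2 h, add_zero]
  smul_mem' := by
    intro c p hp d
    refine ⟨fun h => ?_, fun h => ?_⟩
    · rw [coeff_smul]
      exact Submodule.smul_mem _ c ((hp d).1 h)
    · rw [coeff_smul, (hp d).2 h, smul_zero]

/-- The generator of `Λ(V)` corresponding to a basis vector of `V`: `η_i` or `x_{2n+1}`. -/
def gen (n : ℕ) : Idx n → SuperExt n
  | Sum.inl i => C (eta n i)
  | Sum.inr _ => X

/-- The (left) partial derivative `∂_{η_i}` on the Grassmann algebra: the contraction with the
`i`-th coordinate form, an antiderivation with `η_j ↦ δ_{ij}`. -/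
def grassDeriv (n : ℕ) (i : Fin (2 * n)) : Grass n →ₗ[ℂ] Grass n :=
  CliffordAlgebra.contractLeft (Q := (0 : QuadraticForm ℂ (Fin (2 * n) → ℂ)))
    (LinearMap.proj i : (Fin (2 * n) → ℂ) →ₗ[ℂ] ℂ)

/-- The partial derivatives `∂_{η_i}` (coefficientwise) and `∂_{x_{2n+1}}` on `Λ(V)`. -/
def pderiv (n : ℕ) : Idx n → Module.End ℂ (SuperExt n)
  | Sum.inl i => lsum fun d => ((monomial d).restrictScalars ℂ) ∘ₗ grassDeriv n i
  | Sum.inr _ => derivative.restrictScalars ℂ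

/-- The operator `ε_{i,j}` by which the elementary matrix `E_{i,j} ∈ gl(2n|1)` acts on `Λ(V)`:
multiplication by the `i`-th generator after the `j`-th partial derivative. -/
def eps (n : ℕ) (i j : Idx n) : Module.End ℂ (SuperExt n) :=
  LinearMap.mulLeft ℂ (gen n i) ∘ₗ pderiv n j

/-- The natural action of `gl(2n|1)` (in particular of `spo(2n|1)`) on `Λ(V)`. -/
def act (n : ℕ) (A : Matrix (Idx n) (Idx n) ℂ) : Module.End ℂ (SuperExt n) :=
  ∑ i, ∑ j, A i j • eps n i j

/-- The Laplacian `D_22 = ∂_{x_{2n+1}}² + 2 ∑_{i=1}^n ∂_{η_i} ∂_{η_{2n+1-i}}` on `Λ(V)`. -/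
def laplacian (n : ℕ) : Module.End ℂ (SuperExt n) :=
  pderiv n (Sum.inr ()) ∘ₗ pderiv n (Sum.inr ()) +
    (2 : ℂ) • ∑ i : Fin n, pderiv n (Sum.inl (emb n i)) ∘ₗ pderiv n (Sum.inl (emb n i).rev)

/-- Harmonic elements of `Λ(V)`. -/
def IsHarmonic (n : ℕ) (p : SuperExt n) : Prop := laplacian n p = 0

/-- `p` is annihilated by the nilradical of the Borel subalgebra of `spo(2n|1)`. -/
def IsSingular (n : ℕ) (p : SuperExt n) : Prop := ∀ A ∈ nPlus n, act n A p = 0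

/-- `p` is an `spo(2n|1)`-highest weight vector of highest weight `wt`. -/
def IsHighestWeightVector (n : ℕ) (p : SuperExt n) (wt : Fin n → ℂ) : Prop :=
  p ≠ 0 ∧ IsSingular n p ∧ ∀ i : Fin n, act n (cartanElt n i) p = wt i • p

/-! ## The explicit vectors -/

/-- `η(I) = η_{i_1} ⋯ η_{i_a}` for `I = {i_1 < ⋯ < i_a}`. -/
def etaSet (n : ℕ) (I : Finset (Fin (2 * n))) : Grass n :=
  ((I.sort (· ≤ ·)).map (eta n)).prod

/-- The set `[k] = {1, …, k}`, for `k ≤ 2n`. -/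
def initialSeg (n k : ℕ) : Finset (Fin (2 * n)) := Finset.univ.filter fun i => i.val < k

/-- The set `{2n - k + 2, …, n}`; with indices counted from zero, `{2n + 1 - k, …, n - 1}`. -/
def midSeg (n k : ℕ) : Finset (Fin (2 * n)) :=
  Finset.univ.filter fun i => 2 * n + 1 - k ≤ i.val ∧ i.val < n

/-- `b_a = ∏_{r=0}^{a-1} (2(k - n - r) - 1)`. -/
def bCoeff (n k a : ℕ) : ℂ := ∏ r ∈ Finset.range a, (2 * ((k : ℂ) - n - r) - 1)

/-- The vector `Δ_k`, for `n + 1 ≤ k ≤ 2n + 1`. -/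
def Delta (n k : ℕ) : SuperExt n :=
  ∑ a ∈ Finset.range (k - n), bCoeff n k a •
    (X ^ (2 * (k - n - a) - 1) *
      C (∑ I ∈ (midSeg n k).powersetCard a,
        etaSet n (initialSeg n (2 * n + 1 - k) ∪ I ∪ I.image Fin.rev)))

/-- The vector `s_{n,k}`, for `0 ≤ k ≤ 2n + 1`. -/
def sVec (n k : ℕ) : SuperExt n :=
  if k ≤ n then C (etaSet n (initialSeg n k)) else Delta n k

/-- The weight `(1_m, 0_{n-m})`. -/
def onesWeight (n m : ℕ) : Fin n → ℂ := fun i => if i.val < m then 1 else 0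

end SpoHarmonic

end

/-! Write p = ∑ x^d p_d with p_d in the Grassmann algebra. Harmonicity is the recurrence (d+2)(d+1)
p_{d+2} = -2 ∑_k ∂_{η_k} ∂_{η_{2n+1-k}} p_d, so p_0 and p_1 determine a harmonic p. The odd root
vectors η_k ∂_x + x ∂_{η_{2n+1-k}} give η_k p_1 = 0 and (d+2) η_k p_{d+2} = -∂_{η_{2n+1-k}} p_d.

Apply ∂_{η_k} to the last relation, sum over k ≤ n and compare with the recurrence. Since ∑_k
∂_{η_k} η_k multiplies η(S) by the number c of k ≤ n outside S, the coefficient of η(S) in p_{d+2}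
is killed by (d+2)(d+1-2c). For even d this factor is nonzero, so p_2 = p_4 = ... = 0
(`coeff_eq_zero_of_even`). Hence p_0 involves only η_1, ..., η_n, while every monomial of p_1
contains η_1 ⋯ η_n, and the even root vectors force the index sets to be initial segments
(`grassCoord_coeff_zero`, `grassCoord_coeff_one`). What survives is η([k]) with k ≤ n and x η([k-1])
with k > n: one free coefficient in each degree 0, ..., 2n+1 (`eq_zero_of_leadingCoord`).

Conversely, removing j from I and the choice of b_a give `Delta_odd_relation`. In Δ_k every
coefficient p_{d+2} with d ≥ 1 has d+1 = 2c, so the odd relation now implies harmonicity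
(`isHarmonic_Delta`). The contraction commutes with sp(2n), so the even nilradical need only be
tested on p_0 = 0 and on p_1, a multiple of η([k-1]) (`evenAct_coeff_eq_zero`). -/

noncomputable section

namespace SpoHarmonic

open Polynomial

/-! ## Monomials in the Grassmann algebra -/

/-- The sign `(-1)^{#{j ∈ S : j < i}}` picked up when `η_i` is moved into its place in `η(S)`. -/
def koszulSign {n : ℕ} (i : Fin (2 * n)) (S : Finset (Fin (2 * n))) : ℂ :=
  (-1) ^ (S.filter (· < i)).card

lemma koszulSign_mul_self {n : ℕ} (i : Fin (2 * n)) (S : Finset (Fin (2 * n))) :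
    koszulSign i S * koszulSign i S = 1 := by
  rw [koszulSign, ← mul_pow]; simp

lemma koszulSign_ne_zero {n : ℕ} (i : Fin (2 * n)) (S : Finset (Fin (2 * n))) :
    koszulSign i S ≠ 0 := by
  intro h
  simpa [h] using koszulSign_mul_self i S

lemma koszulSign_insert_self {n : ℕ} (i : Fin (2 * n)) (S : Finset (Fin (2 * n))) :
    koszulSign i (insert i S) = koszulSign i S := by
  simp [koszulSign, Finset.filter_insert]

lemma koszulSign_erase_self {n : ℕ} (i : Fin (2 * n)) (S : Finset (Fin (2 * n))) :
    koszulSign i (S.erase i) = koszulSign i S := by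
  rw [koszulSign, koszulSign, Finset.filter_erase, Finset.erase_eq_of_notMem (by simp)]

lemma koszulSign_insert_of_lt {n : ℕ} {i a : Fin (2 * n)} {S : Finset (Fin (2 * n))}
    (h : a < i) (ha : a ∉ S) : koszulSign i (insert a S) = -koszulSign i S := by
  rw [koszulSign, koszulSign, Finset.filter_insert, if_pos h,
    Finset.card_insert_of_notMem (by simp [ha]), pow_succ]
  ring

lemma koszulSign_of_forall_lt {n : ℕ} {i : Fin (2 * n)} {S : Finset (Fin (2 * n))}
    (h : ∀ j ∈ S, i ≤ j) : koszulSign i S = 1 := by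
  rw [koszulSign, Finset.filter_eq_empty_iff.2 (fun j hj => not_lt.2 (h j hj))]; simp

lemma etaSet_empty (n : ℕ) : etaSet n ∅ = 1 := by simp [etaSet]

lemma etaSet_insert_of_forall_lt {n : ℕ} {a : Fin (2 * n)} {S : Finset (Fin (2 * n))}
    (h : ∀ j ∈ S, a < j) : etaSet n (insert a S) = eta n a * etaSet n S := by
  rw [etaSet, Finset.sort_insert _ (fun b hb => (h b hb).le) (fun ha => lt_irrefl _ (h a ha))]
  simp [etaSet]

lemma eta_mul_self (n : ℕ) (i : Fin (2 * n)) : eta n i * eta n i = 0 :=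
  ExteriorAlgebra.ι_sq_zero _

lemma eta_mul_eta (n : ℕ) (i j : Fin (2 * n)) : eta n i * eta n j = -(eta n j * eta n i) :=
  eq_neg_of_add_eq_zero_left (ExteriorAlgebra.ι_add_mul_swap _ _)

/-- Induction by adjoining a new least element a: η_i goes in front of η_a, squares to zero with it,
or anticommutes past it, which is the sign gained by `koszulSign`. -/
lemma eta_mul_etaSet {n : ℕ} (i : Fin (2 * n)) (S : Finset (Fin (2 * n))) :
    eta n i * etaSet n S = if i ∈ S then 0 else koszulSign i S • etaSet n (insert i S) := by
  induction S using Finset.induction_on_min with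
  | empty => simp [koszulSign, etaSet]
  | insert a S ha ih =>
    have haS : a ∉ S := fun h => lt_irrefl _ (ha a h)
    rw [etaSet_insert_of_forall_lt ha]
    rcases lt_trichotomy i a with h | rfl | h
    · have hlt : ∀ j ∈ insert a S, i < j := by
        intro j hj
        rcases Finset.mem_insert.1 hj with rfl | hj
        exacts [h, h.trans (ha j hj)]
      rw [if_neg (fun hi => lt_irrefl _ (hlt i hi)), etaSet_insert_of_forall_lt hlt,
        koszulSign_of_forall_lt (fun j hj => (hlt j hj).le), etaSet_insert_of_forall_lt ha, one_smul]
    · rw [← mul_assoc, eta_mul_self, zero_mul, if_pos (Finset.mem_insert_self _ _)]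
    · rw [← mul_assoc, eta_mul_eta, neg_mul, mul_assoc, ih]
      by_cases hi : i ∈ S
      · simp [hi]
      · have hlt : ∀ j ∈ insert i S, a < j := by
          intro j hj
          rcases Finset.mem_insert.1 hj with rfl | hj
          exacts [h, ha j hj]
        rw [if_neg hi, if_neg (by simp [hi, h.ne']), koszulSign_insert_of_lt h haS,
          Finset.insert_comm, etaSet_insert_of_forall_lt hlt, mul_smul_comm, neg_smul]

lemma grassDeriv_eta_mul {n : ℕ} (i j : Fin (2 * n)) (q : Grass n) :
    grassDeriv n i (eta n j * q) = (if i = j then q else 0) - eta n j * grassDeriv n i q := by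
  have h := CliffordAlgebra.contractLeft_ι_mul
    (Q := (0 : QuadraticForm ℂ (Fin (2 * n) → ℂ)))
    (LinearMap.proj i : (Fin (2 * n) → ℂ) →ₗ[ℂ] ℂ) (Pi.single j 1) q
  refine h.trans ?_
  rw [LinearMap.proj_apply, Pi.single_apply, ite_smul, one_smul, zero_smul]
  rfl

lemma grassDeriv_one (n : ℕ) (i : Fin (2 * n)) : grassDeriv n i 1 = 0 :=
  CliffordAlgebra.contractLeft_one _ _

lemma grassDeriv_comm {n : ℕ} (i j : Fin (2 * n)) (q : Grass n) :
    grassDeriv n i (grassDeriv n j q) = -grassDeriv n j (grassDeriv n i q) :=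
  CliffordAlgebra.contractLeft_comm _ _ _

lemma grassDeriv_etaSet {n : ℕ} (i : Fin (2 * n)) (S : Finset (Fin (2 * n))) :
    grassDeriv n i (etaSet n S) =
      if i ∈ S then koszulSign i S • etaSet n (S.erase i) else 0 := by
  induction S using Finset.induction_on_min with
  | empty => simp [etaSet_empty, grassDeriv_one]
  | insert a S ha ih =>
    have haS : a ∉ S := fun h => lt_irrefl _ (ha a h)
    rw [etaSet_insert_of_forall_lt ha, grassDeriv_eta_mul, ih]
    by_cases hia : i = a
    · subst hia
      simp [haS, koszulSign_insert_self, koszulSign_of_forall_lt (fun j hj => (ha j hj).le)]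
    · by_cases hi : i ∈ S
      · rw [if_neg hia, if_pos hi, if_pos (Finset.mem_insert_of_mem hi),
          koszulSign_insert_of_lt (ha i hi) haS, Finset.erase_insert_of_ne (Ne.symm hia),
          etaSet_insert_of_forall_lt (fun j hj => ha j (Finset.mem_of_mem_erase hj)),
          mul_smul_comm, neg_smul, zero_sub]
      · simp [hi, hia]

/-- The basis `η(S)` of the Grassmann algebra. -/
def grassBasis (n : ℕ) : Module.Basis (Finset (Fin (2 * n))) ℂ (Grass n) :=
  (Pi.basisFun ℂ (Fin (2 * n))).ExteriorAlgebra

lemma etaSet_eq_ιMulti {n k : ℕ} (S : Finset (Fin (2 * n))) (h : S.card = k) :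
    etaSet n S =
      ExteriorAlgebra.ιMulti ℂ k (fun j => Pi.single (S.orderEmbOfFin h j) (1 : ℂ)) := by
  subst h
  rw [ExteriorAlgebra.ιMulti_apply, etaSet]
  congr 1
  apply List.ext_getElem
  · simp
  · intro i h1 h2
    simp [eta, Finset.orderEmbOfFin_apply]

lemma grassBasis_apply {n : ℕ} (S : Finset (Fin (2 * n))) : grassBasis n S = etaSet n S := by
  rw [grassBasis, ExteriorAlgebra.basis_apply, etaSet_eq_ιMulti S rfl]
  simp only [ExteriorAlgebra.ιMulti_family]
  congr 1
  ext j
  simp [Set.powersetCard.ofFinEmbEquiv_symm_apply]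

/-- The coefficient of `η(S)`. -/
def grassCoord (n : ℕ) (S : Finset (Fin (2 * n))) : Grass n →ₗ[ℂ] ℂ := (grassBasis n).coord S

lemma grassCoord_etaSet {n : ℕ} (S T : Finset (Fin (2 * n))) :
    grassCoord n S (etaSet n T) = if T = S then 1 else 0 := by
  rw [grassCoord, ← grassBasis_apply, Module.Basis.coord_apply, Module.Basis.repr_self,
    Finsupp.single_apply]

lemma eq_of_grassCoord {n : ℕ} {q r : Grass n} (h : ∀ S, grassCoord n S q = grassCoord n S r) :
    q = r :=
  (grassBasis n).ext_elem h

lemma etaSet_mem {n : ℕ} (S : Finset (Fin (2 * n))) :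
    etaSet n S ∈ ⋀[ℂ]^S.card (Fin (2 * n) → ℂ) := by
  rw [etaSet_eq_ιMulti S rfl]
  exact ExteriorAlgebra.ιMulti_range ℂ S.card ⟨_, rfl⟩

/-- Transpose of `eta_mul_etaSet`, checked on the basis. With `grassCoord_grassDeriv` it lets
operator equations on an arbitrary element be read one monomial at a time. -/
lemma grassCoord_eta_mul {n : ℕ} (i : Fin (2 * n)) (q : Grass n) (S : Finset (Fin (2 * n))) :
    grassCoord n S (eta n i * q) =
      if i ∈ S then koszulSign i S * grassCoord n (S.erase i) q else 0 := by
  suffices h : grassCoord n S ∘ₗ LinearMap.mulLeft ℂ (eta n i) =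
      (if i ∈ S then koszulSign i S else 0) • grassCoord n (S.erase i) by
    have := LinearMap.congr_fun h q
    rw [LinearMap.smul_apply, smul_eq_mul, ite_mul, zero_mul] at this
    exact this
  refine (grassBasis n).ext fun T => ?_
  simp only [grassBasis_apply, LinearMap.comp_apply, LinearMap.mulLeft_apply, eta_mul_etaSet,
    LinearMap.smul_apply, grassCoord_etaSet, smul_eq_mul]
  by_cases hT : i ∈ T
  · have : T ≠ S.erase i := by rintro rfl; simp at hT
    simp [hT, this]
  · by_cases h : T = S.erase i
    · subst h
      by_cases hS : i ∈ S
      · simp [hS, Finset.insert_erase, koszulSign_erase_self, grassCoord_etaSet]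
      · have : insert i (S.erase i) ≠ S := by
          intro h; exact hS (h ▸ Finset.mem_insert_self _ _)
        simp [hS, grassCoord_etaSet]
    · have : insert i T ≠ S := by
        rintro rfl; simp [hT] at h
      simp [hT, h, this, grassCoord_etaSet]

lemma grassCoord_grassDeriv {n : ℕ} (i : Fin (2 * n)) (q : Grass n) (S : Finset (Fin (2 * n))) :
    grassCoord n S (grassDeriv n i q) =
      if i ∈ S then 0 else koszulSign i S * grassCoord n (insert i S) q := by
  suffices h : grassCoord n S ∘ₗ grassDeriv n i =
      (if i ∈ S then 0 else koszulSign i S) • grassCoord n (insert i S) by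
    have := LinearMap.congr_fun h q
    rw [LinearMap.smul_apply, smul_eq_mul, ite_mul, zero_mul] at this
    exact this
  refine (grassBasis n).ext fun T => ?_
  simp only [grassBasis_apply, LinearMap.comp_apply, grassDeriv_etaSet,
    LinearMap.smul_apply, grassCoord_etaSet, smul_eq_mul]
  by_cases hT : i ∈ T
  · by_cases h : T = insert i S
    · subst h
      by_cases hS : i ∈ S
      · have : S.erase i ≠ S := by intro h; rw [← h] at hS; simp at hS
        simp [hS, grassCoord_etaSet]
      · simp [hS, koszulSign_insert_self, grassCoord_etaSet]
    · have : T.erase i ≠ S := by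
        rintro rfl; simp [Finset.insert_erase hT] at h
      simp [hT, h, this, grassCoord_etaSet]
  · have : T ≠ insert i S := by rintro rfl; simp at hT
    simp [hT, this]

/-- Induction on the power of V_0: multiplication by a vector is a combination of multiplications by
the η_j, each raising the size of the index set by one. -/
lemma grassCoord_eq_zero_of_mem {n k : ℕ} {q : Grass n} (hq : q ∈ ⋀[ℂ]^k (Fin (2 * n) → ℂ))
    {S : Finset (Fin (2 * n))} (hS : S.card ≠ k) : grassCoord n S q = 0 := by
  revert S
  induction hq using Submodule.pow_induction_on_left' with
  | algebraMap r =>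
    intro S hS
    rw [Algebra.algebraMap_eq_smul_one, map_smul, ← etaSet_empty, grassCoord_etaSet, if_neg,
      smul_zero]
    rintro rfl
    exact hS rfl
  | add x y i hx hy ihx ihy =>
    intro S hS
    rw [map_add, ihx hS, ihy hS, add_zero]
  | mem_mul m hm i x hx ih =>
    intro S hS
    obtain ⟨v, rfl⟩ := hm
    have hv : ExteriorAlgebra.ι ℂ v = ∑ j, v j • eta n j := by
      conv_lhs => rw [← Finset.univ_sum_single v, map_sum]
      refine Finset.sum_congr rfl fun j _ => ?_
      rw [eta, ← map_smul, ← Pi.single_smul, smul_eq_mul, mul_one]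
    rw [hv, Finset.sum_mul, map_sum]
    refine Finset.sum_eq_zero fun j _ => ?_
    rw [smul_mul_assoc, map_smul, grassCoord_eta_mul]
    split_ifs with hj
    · rw [ih, mul_zero, smul_zero]
      rw [Finset.card_erase_of_mem hj]
      have := Finset.card_pos.2 ⟨j, hj⟩
      omega
    · rw [smul_zero]

/-! ## The operators in terms of the coefficients of the powers of `x` -/

lemma coeff_pderiv_inl {n : ℕ} (i : Fin (2 * n)) (p : SuperExt n) (d : ℕ) :
    (pderiv n (Sum.inl i) p).coeff d = grassDeriv n i (p.coeff d) := by
  simp only [pderiv, lsum_apply, LinearMap.comp_apply, LinearMap.restrictScalars_apply]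
  rw [sum_def, finsetSum_coeff]
  simp only [coeff_monomial]
  rw [Finset.sum_ite_eq' p.support d (fun e => grassDeriv n i (p.coeff e))]
  split_ifs with h
  · rfl
  · rw [notMem_support_iff.1 h, map_zero]

lemma coeff_pderiv_inr {n : ℕ} (p : SuperExt n) (d : ℕ) :
    (pderiv n (Sum.inr ()) p).coeff d = ((d : ℂ) + 1) • p.coeff (d + 1) := by
  simp only [pderiv, LinearMap.restrictScalars_apply, coeff_derivative]
  rw [add_smul, one_smul, mul_add, mul_one, Nat.cast_smul_eq_nsmul, nsmul_eq_mul, Nat.cast_comm]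

/-- The operator `∑_{i=1}^n ∂_{η_i} ∂_{η_{2n+1-i}}` on the Grassmann algebra. -/
def contraction (n : ℕ) : Module.End ℂ (Grass n) :=
  ∑ i : Fin n, grassDeriv n (emb n i) ∘ₗ grassDeriv n (emb n i).rev

lemma contraction_apply {n : ℕ} (q : Grass n) :
    contraction n q = ∑ i : Fin n, grassDeriv n (emb n i) (grassDeriv n (emb n i).rev q) := by
  simp [contraction]

lemma coeff_laplacian {n : ℕ} (p : SuperExt n) (d : ℕ) :
    (laplacian n p).coeff d =
      (((d : ℂ) + 2) * (d + 1)) • p.coeff (d + 2) + (2 : ℂ) • contraction n (p.coeff d) := by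
  simp only [laplacian, LinearMap.add_apply, LinearMap.comp_apply, LinearMap.smul_apply,
    LinearMap.sum_apply, coeff_add, coeff_smul, finsetSum_coeff, coeff_pderiv_inl,
    coeff_pderiv_inr, contraction_apply, smul_smul]
  congr 2
  push_cast
  ring

lemma isHarmonic_iff {n : ℕ} (p : SuperExt n) :
    IsHarmonic n p ↔ ∀ d : ℕ, (((d : ℂ) + 2) * (d + 1)) • p.coeff (d + 2) +
      (2 : ℂ) • contraction n (p.coeff d) = 0 := by
  rw [IsHarmonic, Polynomial.ext_iff]
  simp only [coeff_laplacian, coeff_zero]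

lemma act_add (n : ℕ) (A B : Matrix (Idx n) (Idx n) ℂ) : act n (A + B) = act n A + act n B := by
  simp [act, add_smul, Finset.sum_add_distrib]

lemma act_smul (n : ℕ) (c : ℂ) (A : Matrix (Idx n) (Idx n) ℂ) :
    act n (c • A) = c • act n A := by
  simp [act, mul_smul, Finset.smul_sum]

lemma act_single (n : ℕ) (i j : Idx n) : act n (Matrix.single i j 1) = eps n i j := by
  rw [act, Finset.sum_eq_single i, Finset.sum_eq_single j]
  · simp
  · intro b _ hb; simp [hb.symm]
  · simp
  · intro b _ hb; simp [hb.symm]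
  · simp

lemma act_sub (n : ℕ) (A B : Matrix (Idx n) (Idx n) ℂ) : act n (A - B) = act n A - act n B := by
  rw [eq_sub_iff_add_eq, ← act_add, sub_add_cancel]

lemma coeff_eps_inl_inl {n : ℕ} (i j : Fin (2 * n)) (p : SuperExt n) (d : ℕ) :
    (eps n (Sum.inl i) (Sum.inl j) p).coeff d = eta n i * grassDeriv n j (p.coeff d) := by
  simp [eps, gen, coeff_pderiv_inl]

lemma coeff_eps_inl_inr {n : ℕ} (i : Fin (2 * n)) (p : SuperExt n) (d : ℕ) :
    (eps n (Sum.inl i) (Sum.inr ()) p).coeff d = ((d : ℂ) + 1) • (eta n i * p.coeff (d + 1)) := by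
  simp [eps, gen, coeff_pderiv_inr]

lemma coeff_eps_inr_inl_zero {n : ℕ} (j : Fin (2 * n)) (p : SuperExt n) :
    (eps n (Sum.inr ()) (Sum.inl j) p).coeff 0 = 0 := by
  simp [eps, gen]

lemma coeff_eps_inr_inl_succ {n : ℕ} (j : Fin (2 * n)) (p : SuperExt n) (d : ℕ) :
    (eps n (Sum.inr ()) (Sum.inl j) p).coeff (d + 1) = grassDeriv n j (p.coeff d) := by
  simp [eps, gen, coeff_pderiv_inl]

/-- The operator on the Grassmann algebra by which the `gl(2n)`-block of a matrix acts. -/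
def evenAct (n : ℕ) (A : Matrix (Idx n) (Idx n) ℂ) : Module.End ℂ (Grass n) :=
  ∑ i, ∑ j, A (Sum.inl i) (Sum.inl j) • (LinearMap.mulLeft ℂ (eta n i) ∘ₗ grassDeriv n j)

lemma evenAct_apply {n : ℕ} (A : Matrix (Idx n) (Idx n) ℂ) (q : Grass n) :
    evenAct n A q = ∑ i, ∑ j, A (Sum.inl i) (Sum.inl j) • (eta n i * grassDeriv n j q) := by
  simp [evenAct]

/-- On the odd line the form is symmetric and nonzero, so invariance reads 2A = 0. Even elements
thus act through their gl(2n)-block alone. -/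
lemma apply_inr_inr_of_mem_spoPart_zero {n : ℕ} {A : Matrix (Idx n) (Idx n) ℂ}
    (hA : A ∈ spoPart n 0) : A (Sum.inr ()) (Sum.inr ()) = 0 := by
  have h := hA.2 (Sum.inr ()) (Sum.inr ())
  simp [Matrix.mul_apply, formB] at h
  exact h

lemma coeff_act_of_mem_spoPart_zero {n : ℕ} {A : Matrix (Idx n) (Idx n) ℂ}
    (hA : A ∈ spoPart n 0) (p : SuperExt n) (d : ℕ) :
    (act n A p).coeff d = evenAct n A (p.coeff d) := by
  have h1 : ∀ i : Fin (2 * n), A (Sum.inl i) (Sum.inr ()) = 0 := fun i =>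
    hA.1 _ _ (by simp [par])
  have h2 : ∀ i : Fin (2 * n), A (Sum.inr ()) (Sum.inl i) = 0 := fun i =>
    hA.1 _ _ (by simp [par])
  simp [act, Fintype.sum_sum_type, h1, h2, apply_inr_inr_of_mem_spoPart_zero hA,
    LinearMap.sum_apply, evenAct_apply, coeff_eps_inl_inl]

/-- Even elements preserve the power of x. In an odd root vector ∂_x lowers it and x raises it, so
p_{d+2} and p_d meet at x^{d+1}; at x^0 only p_1 contributes, whence the separate middle condition.
-/
lemma isSingular_iff {n : ℕ} (p : SuperExt n) :
    IsSingular n p ↔ (∀ A ∈ nPlusEven n, ∀ d, evenAct n A (p.coeff d) = 0) ∧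
      (∀ k : Fin n, eta n (emb n k) * p.coeff 1 = 0) ∧
      ∀ (k : Fin n) (d : ℕ), ((d : ℂ) + 2) • (eta n (emb n k) * p.coeff (d + 2)) +
        grassDeriv n (emb n k).rev (p.coeff d) = 0 := by
  have hodd : ∀ k, act n (oddRootElt n k) p = 0 ↔ (eta n (emb n k) * p.coeff 1 = 0 ∧
      ∀ d : ℕ, ((d : ℂ) + 2) • (eta n (emb n k) * p.coeff (d + 2)) +
        grassDeriv n (emb n k).rev (p.coeff d) = 0) := by
    intro k
    rw [oddRootElt, act_add, act_single, act_single, Polynomial.ext_iff]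
    constructor
    · intro h
      refine ⟨?_, fun d => ?_⟩
      · have := h 0
        simpa [coeff_eps_inl_inr, coeff_eps_inr_inl_zero] using this
      · have := h (d + 1)
        rw [LinearMap.add_apply, coeff_add, coeff_eps_inl_inr, coeff_eps_inr_inl_succ,
          coeff_zero] at this
        rw [← this]
        congr 2
        push_cast
        ring
    · rintro ⟨h0, h⟩ (_ | d)
      · simp [coeff_eps_inl_inr, coeff_eps_inr_inl_zero, h0]
      · rw [LinearMap.add_apply, coeff_add, coeff_eps_inl_inr, coeff_eps_inr_inl_succ,
          coeff_zero, ← h d]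
        congr 2
        push_cast
        ring
  have heven : ∀ A ∈ nPlusEven n, act n A p = 0 ↔ ∀ d, evenAct n A (p.coeff d) = 0 := by
    intro A hA
    rw [Polynomial.ext_iff]
    simp only [coeff_act_of_mem_spoPart_zero hA.1, coeff_zero]
  constructor
  · intro h
    have hQ := fun k => (hodd k).1 (h _ (Submodule.mem_sup_right
      (Submodule.subset_span ⟨k, rfl⟩)))
    exact ⟨fun A hA => (heven A hA).1 (h A (Submodule.mem_sup_left hA)), fun k => (hQ k).1,
      fun k => (hQ k).2⟩
  · rintro ⟨h1, h2, h3⟩ A hA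
    -- The matrices annihilating p form a subspace, so it suffices to test the spanning elements.
    let K : Submodule ℂ (Matrix (Idx n) (Idx n) ℂ) :=
      { carrier := {A | act n A p = 0}
        zero_mem' := by simp [act]
        add_mem' := by
          intro A B hA hB
          simp only [Set.mem_ofPred_eq] at *
          rw [act_add, LinearMap.add_apply, hA, hB, add_zero]
        smul_mem' := by
          intro c A hA
          simp only [Set.mem_ofPred_eq] at *
          rw [act_smul, LinearMap.smul_apply, hA, smul_zero] }
    have hK : nPlus n ≤ K := by
      refine sup_le (fun A hA => (heven A hA).2 (h1 A hA)) (Submodule.span_le.2 ?_)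
      rintro _ ⟨k, rfl⟩
      exact (hodd k).2 ⟨h2 k, h3 k⟩
    exact hK hA

/-! ## The root vectors `E_{i,j} - E_{2n+1-j,2n+1-i}` -/

/-- The element `E_{i,j} - E_{2n+1-j,2n+1-i}` of `sp(2n)`, for `1 ≤ i, j ≤ n`. -/
def raisingElt (n : ℕ) (i j : Fin n) : Matrix (Idx n) (Idx n) ℂ :=
  Matrix.single (Sum.inl (emb n i)) (Sum.inl (emb n j)) 1 -
    Matrix.single (Sum.inl (emb n j).rev) (Sum.inl (emb n i).rev) 1

lemma raisingElt_mem_spoPart (n : ℕ) (i j : Fin n) : raisingElt n i j ∈ spoPart n 0 := by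
  have hi := i.isLt
  have hj := j.isLt
  constructor
  · rintro (a | a) (b | b) <;> simp [par, raisingElt]
  · rintro (a | a) (b | b)
    all_goals simp only [raisingElt, Matrix.transpose_sub, Matrix.sub_mul, Matrix.mul_sub,
      Matrix.transpose_single, Matrix.sub_apply]
    all_goals simp [Matrix.mul_apply, Matrix.single_apply, formB, emb, ite_and, Fin.ext_iff]
    all_goals grind

lemma raisingElt_mem_nPlusEven {n : ℕ} {i j : Fin n} (hij : i < j) :
    raisingElt n i j ∈ nPlusEven n := by
  refine ⟨raisingElt_mem_spoPart n i j, fun a b hab => ?_⟩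
  have hi := i.isLt
  have hj := j.isLt
  rw [Fin.lt_def] at hij
  rw [Fin.le_def] at hab
  simp only [raisingElt, Matrix.sub_apply, Matrix.single_apply, emb, Sum.inl.injEq, Fin.ext_iff,
    Fin.val_castLE, Fin.val_rev]
  rw [if_neg (by omega), if_neg (by omega), sub_zero]

lemma coeff_act_raisingElt {n : ℕ} (i j : Fin n) (p : SuperExt n) (d : ℕ) :
    (act n (raisingElt n i j) p).coeff d =
      eta n (emb n i) * grassDeriv n (emb n j) (p.coeff d) -
        eta n (emb n j).rev * grassDeriv n (emb n i).rev (p.coeff d) := by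
  rw [raisingElt, act_sub, act_single, act_single, LinearMap.sub_apply, coeff_sub,
    coeff_eps_inl_inl, coeff_eps_inl_inl]

lemma evenAct_raisingElt {n : ℕ} (i j : Fin n) (q : Grass n) :
    evenAct n (raisingElt n i j) q =
      eta n (emb n i) * grassDeriv n (emb n j) q -
        eta n (emb n j).rev * grassDeriv n (emb n i).rev q := by
  have h := coeff_act_raisingElt i j (C q) 0
  rwa [coeff_act_of_mem_spoPart_zero (raisingElt_mem_spoPart n i j), coeff_C_zero] at h

/-! ## Uniqueness of harmonic singular vectors -/

lemma val_emb {n : ℕ} (k : Fin n) : (emb n k).val = k.val := rfl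

lemma exists_emb_eq {n : ℕ} {i : Fin (2 * n)} (h : i.val < n) : ∃ k : Fin n, emb n k = i :=
  ⟨⟨i, h⟩, rfl⟩

lemma exists_emb_rev_eq {n : ℕ} {i : Fin (2 * n)} (h : n ≤ i.val) :
    ∃ k : Fin n, (emb n k).rev = i := by
  obtain ⟨k, hk⟩ := exists_emb_eq (n := n) (i := i.rev) (by rw [Fin.val_rev]; omega)
  exact ⟨k, by rw [hk, Fin.rev_rev]⟩

lemma mem_initialSeg {n k : ℕ} {i : Fin (2 * n)} : i ∈ initialSeg n k ↔ i.val < k := by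
  simp [initialSeg]

lemma card_initialSeg {n k : ℕ} (h : k ≤ 2 * n) : (initialSeg n k).card = k := by
  rw [initialSeg, Fin.card_filter_val_lt, min_eq_right h]

/-- Counting: i ∈ S puts all indices up to i in S, and i ∉ S confines S to the indices below i. -/
lemma eq_initialSeg_of_isLowerSet {n : ℕ} {S : Finset (Fin (2 * n))}
    (h : ∀ a b, a < b → b ∈ S → a ∈ S) : S = initialSeg n S.card := by
  ext i
  rw [mem_initialSeg]
  constructor
  · intro hi
    have : Finset.Iic i ⊆ S := fun a ha => by
      rcases (Finset.mem_Iic.1 ha).lt_or_eq with h' | rfl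
      exacts [h a i h' hi, hi]
    have := Finset.card_le_card this
    rw [Fin.card_Iic] at this
    omega
  · intro hi
    by_contra hS
    have : S ⊆ Finset.Iio i := fun a ha => by
      rw [Finset.mem_Iio]
      by_contra hle
      rcases (not_lt.1 hle).lt_or_eq with h' | rfl
      exacts [hS (h i a h' ha), hS ha]
    have := Finset.card_le_card this
    rw [Fin.card_Iio] at this
    omega

/-- Each ∂_{η_k} η_k is the projection onto the monomials without η_k. -/
lemma grassCoord_sum_grassDeriv_eta_mul {n : ℕ} (q : Grass n) (S : Finset (Fin (2 * n))) :
    grassCoord n S (∑ k : Fin n, grassDeriv n (emb n k) (eta n (emb n k) * q)) =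
      ((Finset.univ.filter fun k : Fin n => emb n k ∉ S).card : ℂ) * grassCoord n S q := by
  rw [map_sum, Finset.card_filter, Nat.cast_sum, Finset.sum_mul]
  refine Finset.sum_congr rfl fun k _ => ?_
  rw [grassCoord_grassDeriv, grassCoord_eta_mul]
  by_cases hk : emb n k ∈ S
  · simp [hk]
  · rw [if_neg hk, if_pos (Finset.mem_insert_self _ _), Finset.erase_insert hk, if_pos hk,
      koszulSign_insert_self, ← mul_assoc, koszulSign_mul_self, Nat.cast_one]

/-- Applying ∂_{η_k} to the odd relation and summing expresses the contraction through a diagonal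
operator, the link between singularity and harmonicity. -/
lemma contraction_of_grassDeriv_eq {n : ℕ} {q r : Grass n} {c : ℂ}
    (h : ∀ k : Fin n, c • (eta n (emb n k) * r) + grassDeriv n (emb n k).rev q = 0) :
    contraction n q = -(c • ∑ k : Fin n, grassDeriv n (emb n k) (eta n (emb n k) * r)) := by
  rw [contraction_apply, Finset.smul_sum, ← Finset.sum_neg_distrib]
  refine Finset.sum_congr rfl fun k _ => ?_
  rw [eq_neg_of_add_eq_zero_right (h k), map_neg, map_smul]

lemma coeff_eq_zero_of_even {n : ℕ} {p : SuperExt n} (hp : IsHarmonic n p) (hs : IsSingular n p)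
    {d : ℕ} (hd : Even d) : p.coeff (d + 2) = 0 := by
  rw [isHarmonic_iff] at hp
  rw [isSingular_iff] at hs
  have h1 := hp d
  rw [contraction_of_grassDeriv_eq (fun k => hs.2.2 k d)] at h1
  refine eq_of_grassCoord fun S => ?_
  have h2 := congrArg (grassCoord n S) h1
  rw [map_add, map_smul, map_smul, map_neg, map_smul, grassCoord_sum_grassDeriv_eta_mul,
    map_zero, smul_eq_mul, smul_eq_mul, smul_eq_mul] at h2
  rw [map_zero]
  set c := (Finset.univ.filter fun k : Fin n => emb n k ∉ S).card
  have h3 : ((d : ℂ) + 2) * ((d : ℂ) + 1 - 2 * c) * grassCoord n S (p.coeff (d + 2)) = 0 := by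
    linear_combination h2
  refine (mul_eq_zero.1 h3).resolve_left (mul_ne_zero ?_ ?_)
  · exact_mod_cast (by omega : d + 2 ≠ 0)
  · rw [sub_ne_zero]
    obtain ⟨e, rfl⟩ := hd
    -- A parity obstruction: d + 1 is odd and 2c is even.
    exact_mod_cast (by omega : e + e + 1 ≠ 2 * c)

lemma coeff_eq_zero_of_coeff_zero_one {n : ℕ} {p : SuperExt n} (hp : IsHarmonic n p)
    (h0 : p.coeff 0 = 0) (h1 : p.coeff 1 = 0) : p = 0 := by
  rw [isHarmonic_iff] at hp
  ext1 d
  rw [coeff_zero]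
  induction d using Nat.twoStepInduction with
  | zero => exact h0
  | one => exact h1
  | more d ih _ =>
    have := hp d
    rw [ih, map_zero, smul_zero, add_zero] at this
    refine (smul_eq_zero.1 this).resolve_left (mul_ne_zero ?_ ?_) <;> norm_cast

/-- The only monomial that η_a ∂_{η_b} sends to the one with b replaced by a is η(S), so no
cancellation can occur. -/
lemma grassCoord_exchange {n : ℕ} {a b : Fin (2 * n)} {S : Finset (Fin (2 * n))} (q : Grass n)
    (ha : a ∉ S) (hb : b ∈ S) :
    grassCoord n (insert a (S.erase b)) (eta n a * grassDeriv n b q) =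
      koszulSign a (S.erase b) * koszulSign b S * grassCoord n S q := by
  rw [grassCoord_eta_mul, if_pos (Finset.mem_insert_self _ _),
    Finset.erase_insert (fun h => ha (Finset.mem_of_mem_erase h)), grassCoord_grassDeriv,
    if_neg (Finset.notMem_erase b S), Finset.insert_erase hb, koszulSign_insert_self,
    koszulSign_erase_self, mul_assoc]

lemma grassCoord_coeff_zero {n : ℕ} {p : SuperExt n} (hp : IsHarmonic n p) (hs : IsSingular n p)
    {S : Finset (Fin (2 * n))} (hS : ∀ k ≤ n, S ≠ initialSeg n k) :
    grassCoord n S (p.coeff 0) = 0 := by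
  have h2 := coeff_eq_zero_of_even hp hs Even.zero
  rw [isSingular_iff] at hs
  by_contra hne
  -- Since p_2 = 0, the odd relation at d = 0 says that every ∂_{η_{2n+1-k}} kills p_0.
  have hbar : ∀ i ∈ S, i.val < n := by
    intro i hi
    by_contra hin
    obtain ⟨k, hk⟩ := exists_emb_rev_eq (not_lt.1 hin)
    have h := congrArg (grassCoord n (S.erase i)) (hs.2.2 k 0)
    rw [h2, mul_zero, smul_zero, zero_add, map_zero, hk, grassCoord_grassDeriv,
      if_neg (Finset.notMem_erase i S), Finset.insert_erase hi] at h
    exact (mul_ne_zero (koszulSign_ne_zero _ _) hne) h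
  have hlow : S = initialSeg n S.card := by
    refine eq_initialSeg_of_isLowerSet fun a b hab hb => ?_
    by_contra ha
    have hbn := hbar b hb
    obtain ⟨j, rfl⟩ := exists_emb_eq hbn
    obtain ⟨i, rfl⟩ := exists_emb_eq (n := n) (i := a) (lt_trans hab hbn)
    have hij : i < j := hab
    have h := congrArg (grassCoord n (insert (emb n i) (S.erase (emb n j))))
      (hs.1 _ (raisingElt_mem_nPlusEven hij) 0)
    -- The second term of the root vector only produces monomials containing η_{2n+1-j}, whereas the
    -- target has indices at most n.
    have hnot : (emb n j).rev ∉ insert (emb n i) (S.erase (emb n j)) := by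
      intro hmem
      have : (emb n j).rev.val < n := by
        rcases Finset.mem_insert.1 hmem with h' | h'
        · rw [h']; exact i.isLt
        · exact hbar _ (Finset.mem_of_mem_erase h')
      rw [Fin.val_rev, val_emb] at this
      omega
    rw [evenAct_raisingElt, map_sub, grassCoord_exchange _ ha hb, grassCoord_eta_mul,
      if_neg hnot, sub_zero, map_zero] at h
    exact mul_ne_zero (mul_ne_zero (koszulSign_ne_zero _ _) (koszulSign_ne_zero _ _)) hne h
  refine hS S.card ?_ hlow
  have : S ⊆ initialSeg n n := fun i hi => mem_initialSeg.2 (hbar i hi)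
  exact (Finset.card_le_card this).trans (card_initialSeg (by omega)).le

lemma grassCoord_coeff_one {n : ℕ} {p : SuperExt n} (hs : IsSingular n p)
    {S : Finset (Fin (2 * n))} (hS : ∀ k, n ≤ k → k ≤ 2 * n → S ≠ initialSeg n k) :
    grassCoord n S (p.coeff 1) = 0 := by
  rw [isSingular_iff] at hs
  by_contra hne
  -- This is η_k p_1 = 0, the dual of the condition on p_0.
  have hmem : ∀ i : Fin (2 * n), i.val < n → i ∈ S := by
    intro i hi
    by_contra hiS
    obtain ⟨k, rfl⟩ := exists_emb_eq hi
    have h := congrArg (grassCoord n (insert (emb n k) S)) (hs.2.1 k)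
    rw [grassCoord_eta_mul, if_pos (Finset.mem_insert_self _ _), Finset.erase_insert hiS,
      map_zero] at h
    exact mul_ne_zero (koszulSign_ne_zero _ _) hne h
  have hlow : S = initialSeg n S.card := by
    refine eq_initialSeg_of_isLowerSet fun a b hab hb => ?_
    by_contra ha
    have han : n ≤ a.val := by
      by_contra h
      exact ha (hmem a (not_le.1 h))
    obtain ⟨j, rfl⟩ := exists_emb_rev_eq han
    obtain ⟨i, rfl⟩ := exists_emb_rev_eq (n := n) (i := b) (han.trans hab.le)
    have hij : i < j := by
      rw [Fin.lt_def, Fin.val_rev, Fin.val_rev, val_emb, val_emb] at hab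
      rw [Fin.lt_def]
      omega
    have h := congrArg (grassCoord n (insert (emb n j).rev (S.erase (emb n i).rev)))
      (hs.1 _ (raisingElt_mem_nPlusEven hij) 1)
    -- Now the first term η_i ∂_{η_j} drops out: the target still contains η_j after η_i is removed,
    -- and ∂_{η_j} leaves no such monomial.
    have hj : emb n j ∈ (insert (emb n j).rev (S.erase (emb n i).rev)).erase (emb n i) := by
      refine Finset.mem_erase.2 ⟨?_, Finset.mem_insert_of_mem (Finset.mem_erase.2 ⟨?_, ?_⟩)⟩
      · rw [Ne, Fin.ext_iff, val_emb, val_emb]; exact (Fin.lt_def.1 hij).ne'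
      · rw [Ne, Fin.ext_iff, Fin.val_rev, val_emb, val_emb]; omega
      · exact hmem _ j.isLt
    rw [evenAct_raisingElt, map_sub, grassCoord_exchange _ ha hb, grassCoord_eta_mul,
      grassCoord_grassDeriv, if_pos hj, mul_zero, ite_self, zero_sub, map_zero, neg_eq_zero] at h
    exact mul_ne_zero (mul_ne_zero (koszulSign_ne_zero _ _) (koszulSign_ne_zero _ _)) hne h
  refine hS S.card ?_ ?_ hlow
  · have : initialSeg n n ⊆ S := fun i hi => hmem i (mem_initialSeg.1 hi)
    exact (card_initialSeg (by omega)).ge.trans (Finset.card_le_card this)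
  · simpa using Finset.card_le_univ S

/-! ### Leading coefficients determine a harmonic singular vector -/

/-- The coefficient of `η([k])` if `k ≤ n`, and that of `x η([k - 1])` if `n < k`. -/
def leadingCoord (n k : ℕ) : SuperExt n →ₗ[ℂ] ℂ :=
  if k ≤ n then grassCoord n (initialSeg n k) ∘ₗ (lcoeff (Grass n) 0).restrictScalars ℂ
  else grassCoord n (initialSeg n (k - 1)) ∘ₗ (lcoeff (Grass n) 1).restrictScalars ℂ

lemma leadingCoord_of_le {n k : ℕ} (h : k ≤ n) (p : SuperExt n) :
    leadingCoord n k p = grassCoord n (initialSeg n k) (p.coeff 0) := by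
  simp [leadingCoord, h]

lemma leadingCoord_of_lt {n k : ℕ} (h : n < k) (p : SuperExt n) :
    leadingCoord n k p = grassCoord n (initialSeg n (k - 1)) (p.coeff 1) := by
  simp [leadingCoord, not_le.2 h]

lemma eq_zero_of_leadingCoord {n : ℕ} {p : SuperExt n} (hp : IsHarmonic n p)
    (hs : IsSingular n p) (h : ∀ k ≤ 2 * n + 1, leadingCoord n k p = 0) : p = 0 := by
  refine coeff_eq_zero_of_coeff_zero_one hp (eq_of_grassCoord fun S => ?_)
    (eq_of_grassCoord fun S => ?_) <;> rw [map_zero]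
  · by_cases hS : ∀ k ≤ n, S ≠ initialSeg n k
    · exact grassCoord_coeff_zero hp hs hS
    · push Not at hS
      obtain ⟨k, hk, rfl⟩ := hS
      rw [← leadingCoord_of_le hk]
      exact h k (by omega)
  · by_cases hS : ∀ k, n ≤ k → k ≤ 2 * n → S ≠ initialSeg n k
    · exact grassCoord_coeff_one hs hS
    · push Not at hS
      obtain ⟨k, hk, hk', rfl⟩ := hS
      -- The factor x contributes one to the degree, hence the shift from k to k + 1.
      have := h (k + 1) (by omega)
      rwa [leadingCoord_of_lt (by omega), Nat.add_sub_cancel] at this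

lemma leadingCoord_eq_zero_of_mem {n j k : ℕ} {p : SuperExt n} (hp : p ∈ superExtPower n k)
    (hj : j ≤ 2 * n + 1) (hjk : j ≠ k) : leadingCoord n j p = 0 := by
  by_cases h : j ≤ n
  · rw [leadingCoord_of_le h]
    refine grassCoord_eq_zero_of_mem ((hp 0).1 (Nat.zero_le k)) ?_
    rw [card_initialSeg (by omega)]
    omega
  · rw [leadingCoord_of_lt (by omega)]
    rcases Nat.eq_zero_or_pos k with rfl | hk
    · rw [(hp 1).2 one_pos, map_zero]
    · refine grassCoord_eq_zero_of_mem ((hp 1).1 hk) ?_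
      rw [card_initialSeg (by omega)]
      omega

/-! ## Invariance of the contraction under `sp(2n)` -/

lemma sum_eq_sum_emb {n : ℕ} {M : Type*} [AddCommMonoid M] (f : Fin (2 * n) → M) :
    ∑ i, f i = ∑ k : Fin n, f (emb n k) + ∑ k : Fin n, f (emb n k).rev := by
  rw [← Finset.sum_filter_add_sum_filter_not Finset.univ (fun i : Fin (2 * n) => i.val < n)]
  congr 1
  · symm
    refine Finset.sum_bij (fun k _ => emb n k) (fun k _ => ?_) (fun a _ b _ h => ?_)
      (fun i hi => ?_) (fun _ _ => rfl)
    · simp [val_emb]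
    · simpa [Fin.ext_iff, val_emb] using h
    · obtain ⟨k, hk⟩ := exists_emb_eq (n := n) (i := i) (by simpa using hi)
      exact ⟨k, Finset.mem_univ _, hk⟩
  · symm
    refine Finset.sum_bij (fun k _ => (emb n k).rev) (fun k _ => ?_) (fun a _ b _ h => ?_)
      (fun i hi => ?_) (fun _ _ => rfl)
    · have := k.isLt
      simp only [Finset.mem_filter, Finset.mem_univ, true_and, Fin.val_rev, val_emb]
      omega
    · simpa [Fin.ext_iff, val_emb] using Fin.rev_injective h
    · obtain ⟨k, hk⟩ := exists_emb_rev_eq (n := n) (i := i) (by simpa using hi)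
      exact ⟨k, Finset.mem_univ _, hk⟩

/-- Each pair {i, 2n+1-i} is counted twice; the antisymmetry of B cancels that of the derivatives.
Writing the contraction through B makes the invariance of B usable. -/
lemma sum_formB_grassDeriv {n : ℕ} (q : Grass n) :
    ∑ a, ∑ b, formB n (Sum.inl a) (Sum.inl b) • grassDeriv n a (grassDeriv n b q) =
      (2 : ℂ) • contraction n q := by
  have h : ∀ a : Fin (2 * n),
      ∑ b, formB n (Sum.inl a) (Sum.inl b) • grassDeriv n a (grassDeriv n b q) =
        (if a.val < n then (1 : ℂ) else -1) • grassDeriv n a (grassDeriv n a.rev q) := by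
    intro a
    simp [formB, ite_smul]
  rw [Finset.sum_congr rfl fun a _ => h a, sum_eq_sum_emb, contraction_apply, two_smul]
  congr 1
  · refine Finset.sum_congr rfl fun k _ => ?_
    rw [if_pos (show (emb n k).val < n from k.isLt), one_smul]
  · refine Finset.sum_congr rfl fun k _ => ?_
    have : ¬ (emb n k).rev.val < n := by
      have := k.isLt
      rw [Fin.val_rev, val_emb]; omega
    rw [if_neg this, Fin.rev_rev, neg_smul, one_smul, grassDeriv_comm, neg_neg]

lemma grassDeriv_evenAct {n : ℕ} (A : Matrix (Idx n) (Idx n) ℂ) (b : Fin (2 * n)) (q : Grass n) :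
    grassDeriv n b (evenAct n A q) =
      ∑ j, A (Sum.inl b) (Sum.inl j) • grassDeriv n j q + evenAct n A (grassDeriv n b q) := by
  have h : ∀ i j, grassDeriv n b (A (Sum.inl i) (Sum.inl j) • (eta n i * grassDeriv n j q)) =
      (if b = i then A (Sum.inl i) (Sum.inl j) • grassDeriv n j q else 0) +
        A (Sum.inl i) (Sum.inl j) • (eta n i * grassDeriv n j (grassDeriv n b q)) := by
    intro i j
    rw [map_smul, grassDeriv_eta_mul, grassDeriv_comm b j, mul_neg, sub_neg_eq_add, smul_add]
    split_ifs <;> simp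
  simp only [evenAct_apply, map_sum, h, Finset.sum_add_distrib]
  congr 1
  rw [Finset.sum_comm]
  simp

/-- By `grassDeriv_evenAct` the commutator is a combination of the ∂_a ∂_b with coefficient matrix
AᵀB + BA, which vanishes on sp(2n). -/
lemma contraction_evenAct {n : ℕ} {A : Matrix (Idx n) (Idx n) ℂ} (hA : A ∈ spoPart n 0)
    (q : Grass n) : contraction n (evenAct n A q) = evenAct n A (contraction n q) := by
  have hinv : ∀ a b : Fin (2 * n),
      ∑ c, A (Sum.inl c) (Sum.inl a) * formB n (Sum.inl c) (Sum.inl b) +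
        ∑ c, formB n (Sum.inl a) (Sum.inl c) * A (Sum.inl c) (Sum.inl b) = 0 := by
    intro a b
    have h := hA.2 (Sum.inl a) (Sum.inl b)
    have h1 : ∀ i : Fin (2 * n), formB n (Sum.inl i) (Sum.inr ()) = 0 := fun _ => rfl
    have h2 : ∀ i : Fin (2 * n), formB n (Sum.inr ()) (Sum.inl i) = 0 := fun _ => rfl
    simpa [Matrix.mul_apply, Fintype.sum_sum_type, h1, h2] using h
  have hcomm : ∀ a b, grassDeriv n a (grassDeriv n b (evenAct n A q)) =
      ∑ j, A (Sum.inl b) (Sum.inl j) • grassDeriv n a (grassDeriv n j q) +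
        ∑ j, A (Sum.inl a) (Sum.inl j) • grassDeriv n j (grassDeriv n b q) +
          evenAct n A (grassDeriv n a (grassDeriv n b q)) := by
    intro a b
    rw [grassDeriv_evenAct, map_add, grassDeriv_evenAct, map_sum, add_assoc]
    simp only [map_smul]
  have h2 : (2 : ℂ) • contraction n (evenAct n A q) =
      (2 : ℂ) • evenAct n A (contraction n q) := by
    rw [← map_smul (evenAct n A), ← sum_formB_grassDeriv, ← sum_formB_grassDeriv]
    simp only [hcomm, smul_add, Finset.sum_add_distrib, map_sum, map_smul, add_eq_right]
    have e1 : ∑ a, ∑ b, formB n (Sum.inl a) (Sum.inl b) •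
        ∑ j, A (Sum.inl b) (Sum.inl j) • grassDeriv n a (grassDeriv n j q) =
        ∑ a, ∑ b, (∑ c, formB n (Sum.inl a) (Sum.inl c) * A (Sum.inl c) (Sum.inl b)) •
          grassDeriv n a (grassDeriv n b q) := by
      refine Finset.sum_congr rfl fun a _ => ?_
      simp only [Finset.smul_sum, Finset.sum_smul, smul_smul]
      exact Finset.sum_comm
    have e2 : ∑ a, ∑ b, formB n (Sum.inl a) (Sum.inl b) •
        ∑ j, A (Sum.inl a) (Sum.inl j) • grassDeriv n j (grassDeriv n b q) =
        ∑ a, ∑ b, (∑ c, A (Sum.inl c) (Sum.inl a) * formB n (Sum.inl c) (Sum.inl b)) •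
          grassDeriv n a (grassDeriv n b q) := by
      rw [Finset.sum_comm]
      conv_rhs => rw [Finset.sum_comm]
      refine Finset.sum_congr rfl fun b _ => ?_
      simp only [Finset.smul_sum, Finset.sum_smul, smul_smul]
      rw [Finset.sum_comm]
      simp only [mul_comm]
    rw [e1, e2, ← Finset.sum_add_distrib]
    refine Finset.sum_eq_zero fun a _ => ?_
    rw [← Finset.sum_add_distrib]
    refine Finset.sum_eq_zero fun b _ => ?_
    rw [← add_smul, add_comm, hinv, zero_smul]
  exact smul_right_injective _ two_ne_zero h2

/-- The harmonic recurrence transports annihilation from p_d to p_{d+2}. -/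
lemma evenAct_coeff_eq_zero {n : ℕ} {p : SuperExt n} (hp : IsHarmonic n p)
    {A : Matrix (Idx n) (Idx n) ℂ} (hA : A ∈ spoPart n 0) (h0 : evenAct n A (p.coeff 0) = 0)
    (h1 : evenAct n A (p.coeff 1) = 0) (d : ℕ) : evenAct n A (p.coeff d) = 0 := by
  rw [isHarmonic_iff] at hp
  induction d using Nat.twoStepInduction with
  | zero => exact h0
  | one => exact h1
  | more d ih _ =>
    have h := congrArg (evenAct n A) (hp d)
    rw [map_add, map_smul, map_smul, ← contraction_evenAct hA, ih, map_zero, smul_zero, add_zero,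
      map_zero] at h
    refine (smul_eq_zero.1 h).resolve_left (mul_ne_zero ?_ ?_) <;> norm_cast

/-! ## The action on monomials -/

lemma eta_mul_grassDeriv_etaSet {n : ℕ} (i : Fin (2 * n)) (S : Finset (Fin (2 * n))) :
    eta n i * grassDeriv n i (etaSet n S) = if i ∈ S then etaSet n S else 0 := by
  rw [grassDeriv_etaSet]
  split_ifs with h
  · rw [mul_smul_comm, eta_mul_etaSet, if_neg (Finset.notMem_erase i S), smul_smul,
      koszulSign_erase_self, koszulSign_mul_self, one_smul, Finset.insert_erase h]
  · rw [mul_zero]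

/-- A strictly upper triangular matrix replaces η_j by some η_i with i < j, which is already a
factor. -/
lemma evenAct_etaSet_initialSeg {n : ℕ} {A : Matrix (Idx n) (Idx n) ℂ} (hA : A ∈ nPlusEven n)
    (k : ℕ) : evenAct n A (etaSet n (initialSeg n k)) = 0 := by
  rw [evenAct_apply]
  refine Finset.sum_eq_zero fun i _ => Finset.sum_eq_zero fun j _ => ?_
  by_cases hij : j ≤ i
  · rw [hA.2 i j hij, zero_smul]
  · rw [grassDeriv_etaSet]
    split_ifs with h
    · have hi : i ∈ (initialSeg n k).erase j := by
        rw [mem_initialSeg] at h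
        rw [Finset.mem_erase, mem_initialSeg]
        exact ⟨(not_le.1 hij).ne, lt_trans (Fin.lt_def.1 (not_le.1 hij)) h⟩
      rw [mul_smul_comm, eta_mul_etaSet, if_pos hi, smul_zero, smul_zero]
    · rw [mul_zero, smul_zero]

lemma act_cartanElt_coeff {n : ℕ} (i : Fin n) (p : SuperExt n) (d : ℕ) :
    (act n (cartanElt n i) p).coeff d =
      eta n (emb n i) * grassDeriv n (emb n i) (p.coeff d) -
        eta n (emb n i).rev * grassDeriv n (emb n i).rev (p.coeff d) :=
  coeff_act_raisingElt i i p d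

lemma sum_grassDeriv_eta_mul_etaSet {n : ℕ} (S : Finset (Fin (2 * n))) :
    ∑ k : Fin n, grassDeriv n (emb n k) (eta n (emb n k) * etaSet n S) =
      ((Finset.univ.filter fun k : Fin n => emb n k ∉ S).card : ℂ) • etaSet n S := by
  refine eq_of_grassCoord fun T => ?_
  rw [grassCoord_sum_grassDeriv_eta_mul, map_smul, smul_eq_mul, grassCoord_etaSet]
  split_ifs with h
  · rw [h]
  · simp

/-! ## The sets `[m] ∪ I ∪ {2n + 1 - i : i ∈ I}` -/

/-- The set `[m] ∪ I ∪ {2n + 1 - i : i ∈ I}`. -/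
def pairSet (n m : ℕ) (I : Finset (Fin (2 * n))) : Finset (Fin (2 * n)) :=
  initialSeg n m ∪ I ∪ I.image Fin.rev

lemma mem_pairSet {n m : ℕ} {I : Finset (Fin (2 * n))} {i : Fin (2 * n)} :
    i ∈ pairSet n m I ↔ i.val < m ∨ i ∈ I ∨ i.rev ∈ I := by
  simp only [pairSet, Finset.mem_union, mem_initialSeg, Finset.mem_image, or_assoc]
  refine or_congr Iff.rfl (or_congr Iff.rfl ⟨?_, fun h => ⟨_, h, Fin.rev_rev i⟩⟩)
  rintro ⟨j, hj, rfl⟩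
  rwa [Fin.rev_rev]

lemma emb_mem_pairSet {n m : ℕ} {I : Finset (Fin (2 * n))}
    (hI : ∀ i ∈ I, m ≤ i.val ∧ i.val < n) (k : Fin n) :
    emb n k ∈ pairSet n m I ↔ k.val < m ∨ emb n k ∈ I := by
  rw [mem_pairSet, val_emb]
  have : (emb n k).rev ∉ I := by
    intro h
    have := (hI _ h).2
    rw [Fin.val_rev, val_emb] at this
    omega
  tauto

lemma emb_rev_mem_pairSet {n m : ℕ} (hm : m ≤ n) {I : Finset (Fin (2 * n))}
    (hI : ∀ i ∈ I, m ≤ i.val ∧ i.val < n) (k : Fin n) :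
    (emb n k).rev ∈ pairSet n m I ↔ emb n k ∈ I := by
  have hk : n ≤ (emb n k).rev.val := by
    rw [Fin.val_rev, val_emb]
    omega
  rw [mem_pairSet, Fin.rev_rev]
  have : (emb n k).rev ∉ I := fun h => absurd (hI _ h).2 (not_lt.2 hk)
  have : ¬ (emb n k).rev.val < m := by omega
  tauto

lemma card_union_initialSeg {n m : ℕ} (hm : m ≤ n) {I : Finset (Fin (2 * n))}
    (hI : ∀ i ∈ I, m ≤ i.val) : (initialSeg n m ∪ I).card = m + I.card := by
  rw [Finset.card_union_of_disjoint, card_initialSeg (by omega)]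
  rw [Finset.disjoint_left]
  intro i hi hi'
  exact absurd (mem_initialSeg.1 hi) (not_lt.2 (hI i hi'))

/-- Reflecting only a part J of I is what the sign count in `koszulSign_pairSet` requires. -/
lemma card_pairSet_of_image {n m : ℕ} (hm : m ≤ n) {I J : Finset (Fin (2 * n))}
    (hI : ∀ i ∈ I, m ≤ i.val ∧ i.val < n) (hJ : J ⊆ I) :
    (initialSeg n m ∪ I ∪ J.image Fin.rev).card = m + I.card + J.card := by
  rw [Finset.card_union_of_disjoint, card_union_initialSeg hm (fun i hi => (hI i hi).1),
    Finset.card_image_of_injective _ Fin.rev_injective]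
  rw [Finset.disjoint_left]
  intro i hi hi'
  obtain ⟨j, hj, rfl⟩ := Finset.mem_image.1 hi'
  have h1 := (hI j (hJ hj)).2
  rcases Finset.mem_union.1 hi with h | h
  · rw [mem_initialSeg, Fin.val_rev] at h
    omega
  · have := (hI _ h).2
    rw [Fin.val_rev] at this
    omega

lemma card_pairSet {n m : ℕ} (hm : m ≤ n) {I : Finset (Fin (2 * n))}
    (hI : ∀ i ∈ I, m ≤ i.val ∧ i.val < n) : (pairSet n m I).card = m + I.card + I.card :=
  card_pairSet_of_image hm hI subset_rfl

lemma card_emb_notMem_pairSet {n m : ℕ} (hm : m ≤ n) {I : Finset (Fin (2 * n))}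
    (hI : ∀ i ∈ I, m ≤ i.val ∧ i.val < n) :
    (Finset.univ.filter fun k : Fin n => emb n k ∉ pairSet n m I).card + (m + I.card) = n := by
  have h : ((Finset.univ.filter fun k : Fin n => emb n k ∈ pairSet n m I).image (emb n)) =
      initialSeg n m ∪ I := by
    ext i
    simp only [Finset.mem_image, Finset.mem_filter, Finset.mem_univ, true_and,
      emb_mem_pairSet hI, Finset.mem_union, mem_initialSeg]
    constructor
    · rintro ⟨k, hk, rfl⟩
      exact hk
    · intro hi
      obtain ⟨k, rfl⟩ := exists_emb_eq (n := n) (i := i)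
        (hi.elim (fun h => by omega) (fun h => (hI i h).2))
      exact ⟨k, hi, rfl⟩
  have hinj : Function.Injective (emb n) := fun a b hab => by
    simpa [Fin.ext_iff, val_emb] using hab
  have hc := Finset.card_filter_add_card_filter_not (s := (Finset.univ : Finset (Fin n)))
    (fun k : Fin n => emb n k ∈ pairSet n m I)
  rw [← Finset.card_image_of_injective _ hinj, h,
    card_union_initialSeg hm (fun i hi => (hI i hi).1), Finset.card_univ, Fintype.card_fin] at hc
  omega

/-- Below 2n+1-j lie [m], all of I and the reflections of the g elements of I above j. Below j lie
[m] and the elements of I smaller than j. The counts differ by 2g + 1, which is odd. -/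
lemma koszulSign_pairSet {n m : ℕ} (hm : m ≤ n) {I : Finset (Fin (2 * n))}
    (hI : ∀ i ∈ I, m ≤ i.val ∧ i.val < n) {j : Fin (2 * n)} (hj : j ∈ I) :
    koszulSign j.rev (pairSet n m I) = -koszulSign j (pairSet n m (I.erase j)) := by
  have hjb := hI j hj
  have e1 : (pairSet n m I).filter (· < j.rev) =
      initialSeg n m ∪ I ∪ (I.filter (j < ·)).image Fin.rev := by
    ext i
    simp only [Finset.mem_filter, mem_pairSet, Finset.mem_union, mem_initialSeg, Finset.mem_image]
    constructor
    · rintro ⟨h | h | h, hlt⟩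
      · exact Or.inl (Or.inl h)
      · exact Or.inl (Or.inr h)
      · exact Or.inr ⟨i.rev, ⟨h, by rwa [Fin.lt_rev_iff]⟩, Fin.rev_rev i⟩
    · rintro ((h | h) | ⟨l, ⟨hl, hlt⟩, rfl⟩)
      · exact ⟨Or.inl h, by rw [Fin.lt_def, Fin.val_rev]; omega⟩
      · exact ⟨Or.inr (Or.inl h), by
          have := hI i h
          rw [Fin.lt_def, Fin.val_rev]; omega⟩
      · exact ⟨Or.inr (Or.inr (by rwa [Fin.rev_rev])), by rwa [Fin.rev_lt_rev]⟩
  have e2 : (pairSet n m (I.erase j)).filter (· < j) = initialSeg n m ∪ I.filter (· < j) := by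
    ext i
    simp only [Finset.mem_filter, mem_pairSet, Finset.mem_union, mem_initialSeg, Finset.mem_erase]
    constructor
    · rintro ⟨h | h | h, hlt⟩
      · exact Or.inl h
      · exact Or.inr ⟨h.2, hlt⟩
      · have := (hI _ h.2).2
        rw [Fin.val_rev] at this
        rw [Fin.lt_def] at hlt
        omega
    · rintro (h | ⟨h, hlt⟩)
      · exact ⟨Or.inl h, by rw [Fin.lt_def]; omega⟩
      · exact ⟨Or.inr (Or.inl ⟨hlt.ne, h⟩), hlt⟩
  have e3 : I.card = (I.filter (· < j)).card + (I.filter (j < ·)).card + 1 := by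
    have h1 := Finset.card_filter_add_card_filter_not (s := I) (· < j)
    have h2 : I.filter (fun i => ¬ i < j) = insert j (I.filter (j < ·)) := by
      ext i
      simp only [Finset.mem_filter, Finset.mem_insert, not_lt]
      constructor
      · rintro ⟨h, hle⟩
        rcases hle.lt_or_eq with h' | rfl
        exacts [Or.inr ⟨h, h'⟩, Or.inl rfl]
      · rintro (rfl | ⟨h, hlt⟩)
        exacts [⟨hj, le_rfl⟩, ⟨h, hlt.le⟩]
    rw [h2, Finset.card_insert_of_notMem (by simp)] at h1
    omega
  rw [koszulSign, koszulSign, e1, e2, card_pairSet_of_image hm hI (Finset.filter_subset _ _),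
    card_union_initialSeg hm (fun i hi => (hI i (Finset.mem_of_mem_filter i hi)).1), e3]
  have hpar : m + ((I.filter (· < j)).card + (I.filter (j < ·)).card + 1) +
      (I.filter (j < ·)).card =
      (m + (I.filter (· < j)).card + 1) + 2 * (I.filter (j < ·)).card := by ring
  rw [hpar, pow_add _ _ (2 * _), pow_mul]
  simp [pow_succ]

lemma grassDeriv_rev_etaSet_pairSet {n m : ℕ} (hm : m ≤ n) {I : Finset (Fin (2 * n))}
    (hI : ∀ i ∈ I, m ≤ i.val ∧ i.val < n) {k : Fin n} (hk : emb n k ∈ I) :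
    grassDeriv n (emb n k).rev (etaSet n (pairSet n m I)) =
      -(eta n (emb n k) * etaSet n (pairSet n m (I.erase (emb n k)))) := by
  have hI' : ∀ i ∈ I.erase (emb n k), m ≤ i.val ∧ i.val < n :=
    fun i hi => hI i (Finset.mem_of_mem_erase hi)
  have hnot : emb n k ∉ pairSet n m (I.erase (emb n k)) := by
    rw [emb_mem_pairSet hI']
    rintro (h | h)
    · exact absurd (hI _ hk).1 (not_le.2 h)
    · exact Finset.notMem_erase _ _ h
  rw [grassDeriv_etaSet, if_pos ((emb_rev_mem_pairSet hm hI k).2 hk), eta_mul_etaSet,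
    if_neg hnot, koszulSign_pairSet hm hI hk, neg_smul]
  congr 3
  ext i
  have hne : (emb n k) ≠ (emb n k).rev := by
    rw [Ne, Fin.ext_iff, Fin.val_rev, val_emb]
    omega
  have hkm := (hI _ hk).1
  have hrev : i.rev = emb n k ↔ i = (emb n k).rev := by
    rw [← Fin.rev_inj, Fin.rev_rev]
  simp only [Finset.mem_erase, Finset.mem_insert, mem_pairSet]
  by_cases h1 : i = emb n k
  · subst h1
    simp [hne, hk]
  · by_cases h2 : i = (emb n k).rev
    · subst h2
      have h3 : (emb n k).rev ∉ I := fun h => by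
        have := (hI _ h).2
        rw [Fin.val_rev, val_emb] at this
        omega
      have h4 : ¬ (emb n k).rev.val < m := by rw [Fin.val_rev, val_emb]; omega
      simp only [h3, h4, h1, Fin.rev_rev, ne_eq, not_true_eq_false, false_and, false_or, and_false]
    · simp [h1, h2, hrev]

/-! ## The vectors `Δ_k` -/

/-- The coefficient `∑_{|I| = a} η([2n + 1 - k] ∪ I ∪ {2n + 1 - i : i ∈ I})` in `Δ_k`. -/
def pairSum (n k a : ℕ) : Grass n :=
  ∑ I ∈ (midSeg n k).powersetCard a, etaSet n (pairSet n (2 * n + 1 - k) I)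

lemma bound_of_mem_powersetCard_midSeg {n k a : ℕ} {I : Finset (Fin (2 * n))}
    (hI : I ∈ (midSeg n k).powersetCard a) : ∀ i ∈ I, 2 * n + 1 - k ≤ i.val ∧ i.val < n := by
  intro i hi
  simpa [midSeg] using (Finset.mem_powersetCard.1 hI).1 hi

lemma coeff_Delta (n k d : ℕ) :
    (Delta n k).coeff d = ∑ a ∈ Finset.range (k - n),
      if d = 2 * (k - n - a) - 1 then bCoeff n k a • pairSum n k a else 0 := by
  rw [Delta, finsetSum_coeff]
  refine Finset.sum_congr rfl fun a _ => ?_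
  rw [coeff_smul, coeff_mul_C, coeff_X_pow, ite_mul, one_mul, zero_mul, smul_ite, smul_zero]
  rfl

lemma coeff_Delta_even {n k d : ℕ} (hd : Even d) : (Delta n k).coeff d = 0 := by
  rw [coeff_Delta]
  refine Finset.sum_eq_zero fun a ha => if_neg ?_
  have := Finset.mem_range.1 ha
  obtain ⟨e, rfl⟩ := hd
  omega

/-- The exponent 2(k-n-a)-1 is parametrised as 2e + 1 with a + e + 1 = k - n, avoiding truncated
subtraction. -/
lemma coeff_Delta_of_add_eq {n k a e : ℕ} (h : a + e + 1 = k - n) :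
    (Delta n k).coeff (2 * e + 1) = bCoeff n k a • pairSum n k a := by
  rw [coeff_Delta, Finset.sum_eq_single a, if_pos (by omega)]
  · intro b hb hba
    have := Finset.mem_range.1 hb
    exact if_neg (by omega)
  · intro ha
    exact absurd (Finset.mem_range.2 (by omega)) ha

lemma coeff_Delta_of_le {n k e : ℕ} (h : k - n ≤ e) : (Delta n k).coeff (2 * e + 1) = 0 := by
  rw [coeff_Delta]
  refine Finset.sum_eq_zero fun a ha => if_neg ?_
  have := Finset.mem_range.1 ha
  omega

/-- The ratio is d + 2 for d = 2e + 1, the power of x that accompanies b_{a+1}; this is the factor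
in the odd relation. -/
lemma bCoeff_succ {n k a e : ℕ} (h : a + e + 2 = k - n) :
    bCoeff n k (a + 1) = ((2 * e + 1 : ℕ) + 2 : ℂ) * bCoeff n k a := by
  have hk : (k : ℂ) = n + a + e + 2 := by
    exact_mod_cast (by omega : k = n + a + e + 2)
  rw [bCoeff, Finset.prod_range_succ, ← bCoeff, hk]
  push_cast
  ring

lemma bCoeff_ne_zero {n k a : ℕ} (h : a ≤ k - n) : bCoeff n k a ≠ 0 := by
  refine Finset.prod_ne_zero_iff.2 fun r hr => ?_
  have := Finset.mem_range.1 hr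
  obtain ⟨e, he⟩ : ∃ e, k = n + r + e + 1 := ⟨k - n - r - 1, by omega⟩
  have hk : (k : ℂ) = n + r + e + 1 := by exact_mod_cast he
  have : 2 * ((k : ℂ) - n - r) - 1 = ((2 * e + 1 : ℕ) : ℂ) := by
    rw [hk]
    push_cast
    ring
  rw [this]
  exact_mod_cast (by omega : 2 * e + 1 ≠ 0)

lemma card_midSeg {n k : ℕ} (h1 : n + 1 ≤ k) (h2 : k ≤ 2 * n + 1) :
    (midSeg n k).card = k - n - 1 := by
  have h : initialSeg n n = initialSeg n (2 * n + 1 - k) ∪ midSeg n k := by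
    ext i
    simp only [Finset.mem_union, mem_initialSeg, midSeg, Finset.mem_filter, Finset.mem_univ,
      true_and]
    omega
  have hc := card_union_initialSeg (n := n) (m := 2 * n + 1 - k) (by omega)
    (I := midSeg n k) (by simp [midSeg]; tauto)
  rw [← h, card_initialSeg (by omega)] at hc
  omega

/-- Only I = `midSeg n k` is large enough, and with its reflection it fills the gap up to k - 1. -/
lemma pairSum_top {n k : ℕ} (h1 : n + 1 ≤ k) (h2 : k ≤ 2 * n + 1) :
    pairSum n k (k - n - 1) = etaSet n (initialSeg n (k - 1)) := by
  rw [pairSum, ← card_midSeg h1 h2, Finset.powersetCard_self, Finset.sum_singleton]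
  congr 1
  ext i
  simp only [mem_pairSet, mem_initialSeg, midSeg, Finset.mem_filter, Finset.mem_univ, true_and,
    Fin.val_rev]
  omega

lemma coeff_one_Delta {n k : ℕ} (h1 : n + 1 ≤ k) (h2 : k ≤ 2 * n + 1) :
    (Delta n k).coeff 1 = bCoeff n k (k - n - 1) • etaSet n (initialSeg n (k - 1)) := by
  rw [← pairSum_top h1 h2]
  exact coeff_Delta_of_add_eq (e := 0) (by omega)

lemma grassDeriv_rev_pairSum_zero {n k : ℕ} (h1 : n + 1 ≤ k) (j : Fin n) :
    grassDeriv n (emb n j).rev (pairSum n k 0) = 0 := by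
  rw [pairSum, Finset.powersetCard_zero, Finset.sum_singleton, grassDeriv_etaSet, if_neg]
  rw [emb_rev_mem_pairSet (by omega) (by simp)]
  simp

/-- Nonzero terms on the left have j ∈ I, those on the right have j in the middle segment outside I.
Removing j matches them, with the sign from `grassDeriv_rev_etaSet_pairSet`. -/
lemma grassDeriv_rev_pairSum_succ {n k : ℕ} (h1 : n + 1 ≤ k) (a : ℕ) (j : Fin n) :
    grassDeriv n (emb n j).rev (pairSum n k (a + 1)) = -(eta n (emb n j) * pairSum n k a) := by
  have hm : 2 * n + 1 - k ≤ n := by omega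
  have hL : ∀ I ∈ (midSeg n k).powersetCard (a + 1),
      grassDeriv n (emb n j).rev (etaSet n (pairSet n (2 * n + 1 - k) I)) ≠ 0 →
        emb n j ∈ I := by
    intro I hI hne
    by_contra h
    rw [grassDeriv_etaSet, if_neg] at hne
    · exact hne rfl
    · rwa [emb_rev_mem_pairSet hm (bound_of_mem_powersetCard_midSeg hI)]
  have hR : ∀ I ∈ (midSeg n k).powersetCard a,
      -(eta n (emb n j) * etaSet n (pairSet n (2 * n + 1 - k) I)) ≠ 0 →
        emb n j ∈ midSeg n k ∧ emb n j ∉ I := by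
    intro I hI hne
    by_contra h
    rw [eta_mul_etaSet, if_pos] at hne
    · exact hne neg_zero
    · rw [emb_mem_pairSet (bound_of_mem_powersetCard_midSeg hI)]
      by_contra h'
      push Not at h'
      refine h ⟨?_, h'.2⟩
      simp only [midSeg, Finset.mem_filter, Finset.mem_univ, true_and]
      exact ⟨h'.1, j.isLt⟩
  rw [pairSum, pairSum, map_sum, Finset.mul_sum, ← Finset.sum_neg_distrib,
    ← Finset.sum_filter_of_ne hL, ← Finset.sum_filter_of_ne hR]
  refine Finset.sum_nbij' (fun I => I.erase (emb n j)) (fun I => insert (emb n j) I) ?_ ?_ ?_ ?_ ?_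
  · intro I hI
    obtain ⟨hI, hj⟩ := Finset.mem_filter.1 hI
    obtain ⟨hs, hc⟩ := Finset.mem_powersetCard.1 hI
    refine Finset.mem_filter.2 ⟨Finset.mem_powersetCard.2
      ⟨(Finset.erase_subset _ _).trans hs, ?_⟩, hs hj, Finset.notMem_erase _ _⟩
    rw [Finset.card_erase_of_mem hj, hc, Nat.add_sub_cancel]
  · intro I hI
    obtain ⟨hI, hj, hjI⟩ := Finset.mem_filter.1 hI
    obtain ⟨hs, hc⟩ := Finset.mem_powersetCard.1 hI
    refine Finset.mem_filter.2 ⟨Finset.mem_powersetCard.2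
      ⟨Finset.insert_subset hj hs, ?_⟩, Finset.mem_insert_self _ _⟩
    rw [Finset.card_insert_of_notMem hjI, hc]
  · intro I hI
    exact Finset.insert_erase (Finset.mem_filter.1 hI).2
  · intro I hI
    exact Finset.erase_insert (Finset.mem_filter.1 hI).2.2
  · intro I hI
    obtain ⟨hI, hj⟩ := Finset.mem_filter.1 hI
    exact grassDeriv_rev_etaSet_pairSet hm (bound_of_mem_powersetCard_midSeg hI) hj

/-- Every monomial of the sum misses the same number n - (2n+1-k) - a = e of the indices up to n. -/
lemma sum_grassDeriv_eta_mul_pairSum {n k a e : ℕ} (h2 : k ≤ 2 * n + 1) (h : a + e + 1 = k - n) :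
    ∑ j : Fin n, grassDeriv n (emb n j) (eta n (emb n j) * pairSum n k a) =
      (e : ℂ) • pairSum n k a := by
  simp only [pairSum, Finset.mul_sum, map_sum, Finset.smul_sum]
  rw [Finset.sum_comm]
  refine Finset.sum_congr rfl fun I hI => ?_
  have hc := card_emb_notMem_pairSet (n := n) (m := 2 * n + 1 - k) (by omega)
    (bound_of_mem_powersetCard_midSeg hI)
  rw [(Finset.mem_powersetCard.1 hI).2] at hc
  rw [sum_grassDeriv_eta_mul_etaSet]
  congr 2
  omega

lemma Delta_odd_relation {n k : ℕ} (h1 : n + 1 ≤ k) (j : Fin n) (d : ℕ) :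
    ((d : ℂ) + 2) • (eta n (emb n j) * (Delta n k).coeff (d + 2)) +
      grassDeriv n (emb n j).rev ((Delta n k).coeff d) = 0 := by
  rcases Nat.even_or_odd' d with ⟨e, rfl | rfl⟩
  · rw [coeff_Delta_even ((even_two_mul e).add even_two), coeff_Delta_even (even_two_mul e)]
    simp
  · rw [show 2 * e + 1 + 2 = 2 * (e + 1) + 1 by ring]
    -- The three cases are an interior power of x, the top power (a = 0), and powers beyond it.
    rcases lt_trichotomy (e + 1) (k - n) with h | h | h
    · obtain ⟨a, ha⟩ : ∃ a, a + e + 2 = k - n := ⟨k - n - e - 2, by omega⟩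
      rw [coeff_Delta_of_add_eq (a := a) (by omega), coeff_Delta_of_add_eq (a := a + 1) (by omega),
        map_smul, grassDeriv_rev_pairSum_succ h1, bCoeff_succ ha, mul_smul_comm, smul_smul,
        smul_neg, add_neg_cancel]
    · rw [coeff_Delta_of_le h.ge, coeff_Delta_of_add_eq (a := 0) (by omega), map_smul,
        grassDeriv_rev_pairSum_zero h1]
      simp
    · rw [coeff_Delta_of_le h.le, coeff_Delta_of_le (by omega)]
      simp

lemma isHarmonic_Delta {n k : ℕ} (h1 : n + 1 ≤ k) (h2 : k ≤ 2 * n + 1) :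
    IsHarmonic n (Delta n k) := by
  rw [isHarmonic_iff]
  intro d
  rw [contraction_of_grassDeriv_eq fun j => Delta_odd_relation h1 j d]
  rcases Nat.even_or_odd' d with ⟨e, rfl | rfl⟩
  · rw [coeff_Delta_even ((even_two_mul e).add even_two)]
    simp
  · rw [show 2 * e + 1 + 2 = 2 * (e + 1) + 1 by ring]
    by_cases h : e + 1 < k - n
    · obtain ⟨a, ha⟩ : ∃ a, a + (e + 1) + 1 = k - n := ⟨k - n - e - 2, by omega⟩
      rw [coeff_Delta_of_add_eq ha]
      simp only [mul_smul_comm, map_smul]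
      rw [← Finset.smul_sum, sum_grassDeriv_eta_mul_pairSum h2 ha]
      simp only [smul_smul, smul_neg, ← sub_eq_add_neg, ← sub_smul]
      -- The scalar contains d + 1 - 2c, with d = 2e + 1 and c = e + 1.
      refine (congrArg (· • pairSum n k a) ?_).trans (zero_smul _ _)
      push_cast
      ring
    · rw [coeff_Delta_of_le (not_lt.1 h)]
      simp

lemma isSingular_Delta {n k : ℕ} (h1 : n + 1 ≤ k) (h2 : k ≤ 2 * n + 1) :
    IsSingular n (Delta n k) := by
  rw [isSingular_iff]
  refine ⟨fun A hA d => ?_, fun j => ?_, Delta_odd_relation h1⟩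
  · refine evenAct_coeff_eq_zero (isHarmonic_Delta h1 h2) hA.1 ?_ ?_ d
    · rw [coeff_Delta_even Even.zero, map_zero]
    · rw [coeff_one_Delta h1 h2, map_smul, evenAct_etaSet_initialSeg hA, smul_zero]
  · have := j.isLt
    rw [coeff_one_Delta h1 h2, mul_smul_comm, eta_mul_etaSet,
      if_pos (mem_initialSeg.2 (by rw [val_emb]; omega)), smul_zero]

lemma act_cartanElt_Delta {n k : ℕ} (h1 : n + 1 ≤ k) (i : Fin n) :
    act n (cartanElt n i) (Delta n k) = onesWeight n (2 * n + 1 - k) i • Delta n k := by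
  have hP : ∀ a, eta n (emb n i) * grassDeriv n (emb n i) (pairSum n k a) -
      eta n (emb n i).rev * grassDeriv n (emb n i).rev (pairSum n k a) =
        onesWeight n (2 * n + 1 - k) i • pairSum n k a := by
    intro a
    simp only [pairSum, map_sum, Finset.mul_sum, ← Finset.sum_sub_distrib, Finset.smul_sum]
    refine Finset.sum_congr rfl fun I hI => ?_
    have hb := bound_of_mem_powersetCard_midSeg hI
    rw [eta_mul_grassDeriv_etaSet, eta_mul_grassDeriv_etaSet, onesWeight]
    -- A pair i, 2n+1-i contributes opposite weights, so only the initial segment counts.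
    simp only [emb_mem_pairSet hb, emb_rev_mem_pairSet (by omega : 2 * n + 1 - k ≤ n) hb]
    by_cases hi : i.val < 2 * n + 1 - k
    · have : emb n i ∉ I := fun h => absurd (hb _ h).1 (not_le.2 hi)
      simp [hi, this]
    · simp [hi]
  ext1 d
  rw [act_cartanElt_coeff, coeff_smul]
  rcases Nat.even_or_odd' d with ⟨e, rfl | rfl⟩
  · rw [coeff_Delta_even (even_two_mul e)]
    simp
  · by_cases h : e < k - n
    · obtain ⟨a, ha⟩ : ∃ a, a + e + 1 = k - n := ⟨k - n - e - 1, by omega⟩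
      rw [coeff_Delta_of_add_eq ha, map_smul, map_smul, mul_smul_comm, mul_smul_comm, ← smul_sub,
        hP, smul_comm]
    · rw [coeff_Delta_of_le (not_lt.1 h)]
      simp

lemma Delta_mem_superExtPower {n k : ℕ} (h1 : n + 1 ≤ k) (h2 : k ≤ 2 * n + 1) :
    Delta n k ∈ superExtPower n k := by
  intro d
  rcases Nat.even_or_odd' d with ⟨e, rfl | rfl⟩
  · rw [coeff_Delta_even (even_two_mul e)]
    exact ⟨fun _ => Submodule.zero_mem _, fun _ => rfl⟩
  · by_cases h : e < k - n
    · obtain ⟨a, ha⟩ : ∃ a, a + e + 1 = k - n := ⟨k - n - e - 1, by omega⟩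
      rw [coeff_Delta_of_add_eq ha]
      refine ⟨fun _ => Submodule.smul_mem _ _ (Submodule.sum_mem _ fun I hI => ?_), fun hlt => ?_⟩
      · have hc := card_pairSet (by omega : 2 * n + 1 - k ≤ n)
          (bound_of_mem_powersetCard_midSeg hI)
        rw [(Finset.mem_powersetCard.1 hI).2] at hc
        have := etaSet_mem (pairSet n (2 * n + 1 - k) I)
        rwa [hc, show 2 * n + 1 - k + a + a = k - (2 * e + 1) by omega] at this
      · omega
    · rw [coeff_Delta_of_le (not_lt.1 h)]
      exact ⟨fun _ => Submodule.zero_mem _, fun _ => rfl⟩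

/-! ## The vectors `s_{n,k}` -/

lemma sVec_of_le {n k : ℕ} (h : k ≤ n) : sVec n k = C (etaSet n (initialSeg n k)) := if_pos h

lemma sVec_of_lt {n k : ℕ} (h : n < k) : sVec n k = Delta n k := if_neg (not_le.2 h)

lemma grassDeriv_rev_etaSet_initialSeg {n k : ℕ} (h : k ≤ n) (j : Fin n) :
    grassDeriv n (emb n j).rev (etaSet n (initialSeg n k)) = 0 := by
  rw [grassDeriv_etaSet, if_neg]
  rw [mem_initialSeg, Fin.val_rev, val_emb]
  omega

lemma sVec_mem_superExtPower {n k : ℕ} (hk : k ≤ 2 * n + 1) : sVec n k ∈ superExtPower n k := by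
  rcases le_or_gt k n with h | h
  · rw [sVec_of_le h]
    rintro (_ | d)
    · have := etaSet_mem (initialSeg n k)
      rw [card_initialSeg (by omega)] at this
      simpa using this
    · simp
  · rw [sVec_of_lt h]
    exact Delta_mem_superExtPower h hk

lemma isHarmonic_sVec {n k : ℕ} (hk : k ≤ 2 * n + 1) : IsHarmonic n (sVec n k) := by
  rcases le_or_gt k n with h | h
  · rw [sVec_of_le h, isHarmonic_iff]
    rintro (_ | d)
    · simp [coeff_C, contraction_apply, grassDeriv_rev_etaSet_initialSeg h]
    · simp
  · rw [sVec_of_lt h]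
    exact isHarmonic_Delta h hk

lemma isSingular_sVec {n k : ℕ} (hk : k ≤ 2 * n + 1) : IsSingular n (sVec n k) := by
  rcases le_or_gt k n with h | h
  · rw [sVec_of_le h, isSingular_iff]
    refine ⟨?_, ?_, ?_⟩
    · rintro A hA (_ | d)
      · simp [evenAct_etaSet_initialSeg hA]
      · simp
    · simp
    · rintro j (_ | d)
      · simp [coeff_C, grassDeriv_rev_etaSet_initialSeg h]
      · simp
  · rw [sVec_of_lt h]
    exact isSingular_Delta h hk

lemma act_cartanElt_sVec {n k : ℕ} (i : Fin n) :
    act n (cartanElt n i) (sVec n k) = onesWeight n (min k (2 * n + 1 - k)) i • sVec n k := by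
  rcases le_or_gt k n with h | h
  · rw [sVec_of_le h, min_eq_left (by omega)]
    ext1 d
    rw [act_cartanElt_coeff, coeff_smul]
    rcases d with _ | d
    · rw [coeff_C_zero, eta_mul_grassDeriv_etaSet, grassDeriv_rev_etaSet_initialSeg h, mul_zero,
        sub_zero, onesWeight, ite_smul, one_smul, zero_smul]
      exact if_congr mem_initialSeg rfl rfl
    · simp
  · rw [sVec_of_lt h, min_eq_right (by omega)]
    exact act_cartanElt_Delta h i

lemma leadingCoord_sVec_ne_zero {n k : ℕ} (hk : k ≤ 2 * n + 1) :
    leadingCoord n k (sVec n k) ≠ 0 := by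
  rcases le_or_gt k n with h | h
  · rw [leadingCoord_of_le h, sVec_of_le h, coeff_C_zero, grassCoord_etaSet, if_pos rfl]
    exact one_ne_zero
  · rw [leadingCoord_of_lt h, sVec_of_lt h, coeff_one_Delta h hk, map_smul, grassCoord_etaSet,
      if_pos rfl, smul_eq_mul, mul_one]
    exact bCoeff_ne_zero (by omega)

/-! ### Dimension count and the basis -/

/-- The space of harmonic vectors annihilated by the nilradical. -/
def harmonicSingular (n : ℕ) : Submodule ℂ (SuperExt n) where
  carrier := {p | IsHarmonic n p ∧ IsSingular n p}
  zero_mem' := ⟨map_zero _, fun _ _ => map_zero _⟩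
  add_mem' := by
    rintro p q ⟨h1, h2⟩ ⟨h3, h4⟩
    refine ⟨?_, fun A hA => ?_⟩
    · rw [IsHarmonic] at *
      rw [map_add, h1, h3, add_zero]
    · rw [map_add, h2 A hA, h4 A hA, add_zero]
  smul_mem' := by
    rintro c p ⟨h1, h2⟩
    refine ⟨?_, fun A hA => ?_⟩
    · rw [IsHarmonic] at *
      rw [map_smul, h1, smul_zero]
    · rw [map_smul, h2 A hA, smul_zero]

lemma sVec_mem_harmonicSingular {n k : ℕ} (hk : k ≤ 2 * n + 1) :
    sVec n k ∈ harmonicSingular n :=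
  ⟨isHarmonic_sVec hk, isSingular_sVec hk⟩

/-- Since `leadingCoord n j` reads a monomial of degree j, it sees only the summand of that degree.
-/
lemma leadingCoord_sum_sVec {n j : ℕ} (hj : j ≤ 2 * n + 1) (c : Fin (2 * n + 2) → ℂ) :
    leadingCoord n j (∑ k : Fin (2 * n + 2), c k • sVec n k) =
      c ⟨j, by omega⟩ * leadingCoord n j (sVec n j) := by
  rw [map_sum, Finset.sum_eq_single ⟨j, by omega⟩]
  · rw [map_smul, smul_eq_mul]
  · intro k _ hk
    rw [map_smul, leadingCoord_eq_zero_of_mem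
      (sVec_mem_superExtPower (by omega : k.val ≤ 2 * n + 1)) hj, smul_zero]
    rintro rfl
    exact hk rfl
  · simp

lemma linearIndependent_sVec (n : ℕ) :
    LinearIndependent ℂ (fun k : Fin (2 * n + 2) => sVec n k) := by
  rw [Fintype.linearIndependent_iff]
  intro c hc k
  have hk : k.val ≤ 2 * n + 1 := by omega
  have h := leadingCoord_sum_sVec hk c
  rw [hc, map_zero] at h
  exact (mul_eq_zero.1 h.symm).resolve_right (leadingCoord_sVec_ne_zero hk)

lemma span_sVec (n : ℕ) :
    Submodule.span ℂ (Set.range fun k : Fin (2 * n + 2) => sVec n k) = harmonicSingular n := by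
  refine le_antisymm (Submodule.span_le.2 ?_) fun p hp => ?_
  · rintro _ ⟨k, rfl⟩
    exact sVec_mem_harmonicSingular (by omega)
  · let c : Fin (2 * n + 2) → ℂ := fun k => leadingCoord n k p / leadingCoord n k (sVec n k)
    have hsum : ∑ k : Fin (2 * n + 2), c k • sVec n k ∈ harmonicSingular n :=
      Submodule.sum_mem _ fun k _ =>
        Submodule.smul_mem _ _ (sVec_mem_harmonicSingular (by omega))
    have hr := Submodule.sub_mem _ hp hsum
    have h0 : p - ∑ k : Fin (2 * n + 2), c k • sVec n k = 0 := by
      refine eq_zero_of_leadingCoord hr.1 hr.2 fun k hk => ?_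
      rw [map_sub, leadingCoord_sum_sVec hk, div_mul_cancel₀ _ (leadingCoord_sVec_ne_zero hk),
        sub_self]
    rw [sub_eq_zero.1 h0]
    exact Submodule.sum_mem _ fun k _ =>
      Submodule.smul_mem _ _ (Submodule.subset_span ⟨k, rfl⟩)

lemma eq_smul_sVec_of_mem_superExtPower {n k : ℕ} {p : SuperExt n}
    (hk : p ∈ superExtPower n k) (hp : p ∈ harmonicSingular n) (hne : p ≠ 0) :
    k ≤ 2 * n + 1 ∧ ∃ c : ℂ, c ≠ 0 ∧ p = c • sVec n k := by
  have hk' : k ≤ 2 * n + 1 := by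
    by_contra h
    exact hne (eq_zero_of_leadingCoord hp.1 hp.2 fun j hj =>
      leadingCoord_eq_zero_of_mem hk hj (by omega))
  refine ⟨hk', leadingCoord n k p / leadingCoord n k (sVec n k), ?_, ?_⟩
  · refine div_ne_zero (fun h => hne ?_) (leadingCoord_sVec_ne_zero hk')
    refine eq_zero_of_leadingCoord hp.1 hp.2 fun j hj => ?_
    by_cases hjk : j = k
    · rwa [hjk]
    · exact leadingCoord_eq_zero_of_mem hk hj hjk
  · have hr := Submodule.sub_mem _ hp (Submodule.smul_mem _
      (leadingCoord n k p / leadingCoord n k (sVec n k)) (sVec_mem_harmonicSingular hk'))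
    refine sub_eq_zero.1 (eq_zero_of_leadingCoord hr.1 hr.2 fun j hj => ?_)
    by_cases hjk : j = k
    · subst hjk
      rw [map_sub, map_smul, smul_eq_mul, div_mul_cancel₀ _ (leadingCoord_sVec_ne_zero hk'),
        sub_self]
    · exact leadingCoord_eq_zero_of_mem
        (Submodule.sub_mem _ hk (Submodule.smul_mem _ _ (sVec_mem_superExtPower hk'))) hj hjk

end SpoHarmonic

end

theorem mainTheorem4 (n : ℕ) :
    -- each `s_{n,k}` is a harmonic highest weight vector in `Λ^k(V)`, of the stated weight
    (∀ k : ℕ, k ≤ 2 * n + 1 →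
      SpoHarmonic.sVec n k ∈ SpoHarmonic.superExtPower n k ∧
      SpoHarmonic.IsHarmonic n (SpoHarmonic.sVec n k) ∧
      SpoHarmonic.IsHighestWeightVector n (SpoHarmonic.sVec n k)
        (SpoHarmonic.onesWeight n (min k (2 * n + 1 - k)))) ∧
    -- every homogeneous harmonic highest weight vector is, up to a scalar, one of them
    (∀ (k : ℕ) (p : SpoHarmonic.SuperExt n) (wt : Fin n → ℂ),
      p ∈ SpoHarmonic.superExtPower n k → SpoHarmonic.IsHarmonic n p →
      SpoHarmonic.IsHighestWeightVector n p wt →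
        k ≤ 2 * n + 1 ∧ ∃ c : ℂ, c ≠ 0 ∧ p = c • SpoHarmonic.sVec n k) ∧
    -- the `s_{n,k}` are a basis of the space of all (not necessarily homogeneous) harmonic
    -- vectors that are annihilated by the nilradical of the Borel subalgebra
    LinearIndependent ℂ (fun k : Fin (2 * n + 2) => SpoHarmonic.sVec n k) ∧
    (∀ p : SpoHarmonic.SuperExt n,
      (SpoHarmonic.IsHarmonic n p ∧ SpoHarmonic.IsSingular n p) ↔
        p ∈ Submodule.span ℂ
          (Set.range fun k : Fin (2 * n + 2) => SpoHarmonic.sVec n k)) := by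
  refine ⟨fun k hk => ⟨SpoHarmonic.sVec_mem_superExtPower hk, SpoHarmonic.isHarmonic_sVec hk,
    ?_, SpoHarmonic.isSingular_sVec hk, fun i => SpoHarmonic.act_cartanElt_sVec i⟩,
    fun k p wt hk hp hwt => SpoHarmonic.eq_smul_sVec_of_mem_superExtPower hk ⟨hp, hwt.2.1⟩ hwt.1,
    SpoHarmonic.linearIndependent_sVec n, fun p => ?_⟩
  · intro h
    exact SpoHarmonic.leadingCoord_sVec_ne_zero hk (by rw [h, map_zero])
  · rw [SpoHarmonic.span_sVec]
    rfl
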